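/- Let $\Bbbk$ be a field and $A$ a basic finite-dimensional $\Bbbk$-algebra with a fixed complete ordered set $(e_1,\dots,e_n)$ of primitive orthogonal idempotents (so $e_iA\not\cong e_jA$ for $i\neq j$). Modules are finitely generated right $A$-modules and $\operatorname{mod}A$ is their category. Let $\Theta=(\Theta(1),\dots,\Theta(n))$ be an ordered set of $A$-modules. Definitions. For a module $M$, $\operatorname{add}M$ is the class of direct summands of finite direct sums of copies of $M$. For classes $\mathcal X,\mathcal Y$ of modules, $\mathcal X*\mathcal Y$ is the class of modules $Y$ with a short exact sequence $0\to X\to Y\to Z\to 0$, $X\in\mathcal X$, $Z\in\mathcal Y$. Put $\mathcal F(M)=\bigcup_{l>0}\operatorname{add}M*\cdots*\operatorname{add}M$ ($l$ factors), $\mathcal F(\Theta)=\mathcal F(\Theta(1)\oplus\cdots\oplus\Theta(n))$, $\mathcal F(\Theta(\ge i))=\mathcal F(\bigoplus_{j\ge i}\Theta(j))$ and $\mathcal F(\Theta(\le i))=\mathcal F(\bigoplus_{j\le i}\Theta(j))$. Let $S(i)=e_iA/\operatorname{rad}(e_iA)$. The standard module $\Delta(i)$ is the maximal factor module of $e_iA$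 lying in $\mathcal F(S(1)\oplus\cdots\oplus S(i))$; the proper standard module $\overline\Delta(i)$ is the maximal factor module of $\Delta(i)$ with $\operatorname{rad}\overline\Delta(i)\in\mathcal F(S(1)\oplus\cdots\oplus S(i-1))$. A brick is a module whose endomorphism ring is a division ring; a stone is an indecomposable module $M$ with $\operatorname{Ext}^1_A(M,M)=0$. The algebra $A$ is mixed stratified with respect to $\Theta$ if $A\in\mathcal F(\Theta)$ and, for each $i$, $\Theta(i)$ is isomorphic to $\Delta(i)$ or to $\overline\Delta(i)$. For an ordered set $\mathbb P=(P(1),\dots,P(n))$ of indecomposable modules, $(\Theta,\mathbb P)$ is a mixed stratifying system if each $\Theta(i)$ is a brick or a stone, $\operatorname{Hom}_A(\Theta(i),\Theta(j))=0$ for $i>j$, and for each $i$ there is a short exact sequence $0\to K(i)\to P(i)\to\Theta(i)\to 0$ with $K(i)\in\mathcal F(\Theta(\ge i))$ and $\operatorname{Ext}^1_A(P(i),X)=0$ for all $X\in\mathcal F(\Theta)$. For an ordered set $\mathbb I=(I(1),\dots,I(n))$ of indecomposable modules, $(\Theta,\mathbb I)$ is a mixed costratifying system if each $\Theta(i)$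 is a brick or a stone, $\operatorname{Hom}_A(\Theta(i),\Theta(j))=0$ for $i>j$, and for each $i$ there is a short exact sequence $0\to\Theta(i)\to I(i)\to C(i)\to 0$ with $C(i)\in\mathcal F(\Theta(\le i))$ and $\operatorname{Ext}^1_A(X,I(i))=0$ for all $X\in\mathcal F(\Theta)$. The triple $(\Theta,\mathbb P,\mathbb I)$ is a mixed bistratifying system if $(\Theta,\mathbb P)$ is a mixed stratifying system and $(\Theta,\mathbb I)$ is a mixed costratifying system. In these notions $A$ is regarded as the ordered set $(e_1A,\dots,e_nA)$. Theorem. The following are equivalent: (1) $A$ is a mixed stratified algebra with respect to $\Theta$; (2) $(\Theta,A)$ is a mixed stratifying system in $\operatorname{mod}A$; (3) there is an ordered set $\mathbb T=(T(1),\dots,T(n))$ of $A$-modules such that $(\Theta,A,\mathbb T)$ is a mixed bistratifying system in $\operatorname{mod}A$. -/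

import Mathlib

universe u

namespace MixedStrat

open CategoryTheory

section General

variable {R : Type u} [Ring R]

/-- A brick: a module whose endomorphism ring is a division ring. -/
def IsBrick (M : ModuleCat.{u} R) : Prop :=
  Nontrivial (Module.End R M) ∧ ∀ f : Module.End R M, f ≠ 0 → IsUnit f

/-- A stone: an indecomposable module without self-extensions. -/
def IsStone (M : ModuleCat.{u} R) : Prop :=
  Indecomposable M ∧ Subsingleton (Abelian.Ext.{u} M M 1)

/-- `X` belongs to `add M`: it is a direct summand of a finite direct sum of copies of `M`. -/
def InAdd (M X : ModuleCat.{u} R) : Prop :=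
  ∃ (m : ℕ) (s : X →ₗ[R] (Fin m → M)) (r : (Fin m → M) →ₗ[R] X), r ∘ₗ s = LinearMap.id

/-- The class `F(M) = ⋃_{l > 0} add M * ⋯ * add M` (`l` factors), where `𝒳 * 𝒴` consists of the
modules `Y` that admit a short exact sequence `0 → X → Y → Z → 0` with `X ∈ 𝒳` and `Z ∈ 𝒴`. -/
inductive Filt (M : ModuleCat.{u} R) : ModuleCat.{u} R → Prop
  | of_inAdd {X : ModuleCat.{u} R} (h : InAdd M X) : Filt M X
  | ext {X Y Z : ModuleCat.{u} R} (f : X ⟶ Y) (g : Y ⟶ Z) (w : f ≫ g = 0)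
      (hex : (ShortComplex.mk f g w).ShortExact) (hX : Filt M X) (hZ : InAdd M Z) : Filt M Y

/-- The direct sum of the `Θ j` over those indices `j` that lie in `s`. -/
abbrev dsum {t : ℕ} (Θ : Fin t → ModuleCat.{u} R) (s : Set (Fin t)) : ModuleCat.{u} R :=
  ModuleCat.of R (∀ j : s, Θ j)

/-- The class `F(⨁_{j ∈ s} Θ j)`. So `FiltSet Θ Set.univ` is `F(Θ)`, `FiltSet Θ (Set.Ici i)` is
`F(Θ(≥ i))` and `FiltSet Θ (Set.Iic i)` is `F(Θ(≤ i))`. -/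
def FiltSet {t : ℕ} (Θ : Fin t → ModuleCat.{u} R) (s : Set (Fin t)) (X : ModuleCat.{u} R) : Prop :=
  Filt (dsum Θ s) X

/-- `(Θ, P)` is a mixed stratifying system of size `t` in the category of finitely generated
modules. The conflations of that category are its short exact sequences, and its negative first
extension is zero, so that the condition on the latter is void. (For finitely generated modules
over a noetherian ring, `Ext¹` is the same in all modules as in the finitely generated ones.) -/
structure IsMixedStratifyingSystem {t : ℕ} (Θ P : Fin t → ModuleCat.{u} R) : Prop where
  finite_left : ∀ i, Module.Finite R (Θ i)
  finite_right : ∀ i, Module.Finite R (P i)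
  indecomposable : ∀ i, Indecomposable (P i)
  brick_or_stone : ∀ i, IsBrick (Θ i) ∨ IsStone (Θ i)
  hom_eq_zero : ∀ i j, j < i → ∀ f : Θ i ⟶ Θ j, f = 0
  conflation : ∀ i, ∃ (K : ModuleCat.{u} R) (f : K ⟶ P i) (g : P i ⟶ Θ i) (w : f ≫ g = 0),
    (ShortComplex.mk f g w).ShortExact ∧ FiltSet Θ (Set.Ici i) K
  ext_eq_zero : ∀ i, ∀ X, FiltSet Θ Set.univ X → Subsingleton (Abelian.Ext.{u} (P i) X 1)

/-- `(Θ, I)` is a mixed costratifying system of size `t` in the category of finitely generated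
modules. -/
structure IsMixedCostratifyingSystem {t : ℕ} (Θ I : Fin t → ModuleCat.{u} R) : Prop where
  finite_left : ∀ i, Module.Finite R (Θ i)
  finite_right : ∀ i, Module.Finite R (I i)
  indecomposable : ∀ i, Indecomposable (I i)
  brick_or_stone : ∀ i, IsBrick (Θ i) ∨ IsStone (Θ i)
  hom_eq_zero : ∀ i j, j < i → ∀ f : Θ i ⟶ Θ j, f = 0
  conflation : ∀ i, ∃ (C : ModuleCat.{u} R) (f : Θ i ⟶ I i) (g : I i ⟶ C) (w : f ≫ g = 0),
    (ShortComplex.mk f g w).ShortExact ∧ FiltSet Θ (Set.Iic i) C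
  ext_eq_zero : ∀ i, ∀ X, FiltSet Θ Set.univ X → Subsingleton (Abelian.Ext.{u} X (I i) 1)

/-- `(Θ, P, I)` is a mixed bistratifying system. -/
def IsMixedBistratifyingSystem {t : ℕ} (Θ P I : Fin t → ModuleCat.{u} R) : Prop :=
  IsMixedStratifyingSystem Θ P ∧ IsMixedCostratifyingSystem Θ I

end General

section Algebra

variable {A : Type u} [Ring A]

/-- A primitive idempotent: a nonzero idempotent that is not the sum of two nonzero orthogonal
idempotents. -/
def IsPrimitiveIdempotent (e : A) : Prop :=
  IsIdempotentElem e ∧ e ≠ 0 ∧ ∀ f g : A, IsIdempotentElem f → IsIdempotentElem g →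
    f * g = 0 → g * f = 0 → f + g = e → f = 0 ∨ g = 0

/-! Right `A`-modules are modules over the opposite ring `Aᵐᵒᵖ`. -/

variable {n : ℕ} (e : Fin n → A)

/-- The right module `e i A`, as a submodule of the right module `A`. -/
abbrev P (i : Fin n) : ModuleCat.{u} Aᵐᵒᵖ :=
  ModuleCat.of Aᵐᵒᵖ (Submodule.span Aᵐᵒᵖ {e i} : Submodule Aᵐᵒᵖ A)

/-- The simple right module `S(i) = top (e i A) = e i A / rad (e i A)`. -/
abbrev S (i : Fin n) : ModuleCat.{u} Aᵐᵒᵖ :=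
  ModuleCat.of Aᵐᵒᵖ (P e i ⧸ Module.jacobson Aᵐᵒᵖ (P e i))

/-- The least submodule `N` of `e i A` with `e i A / N ∈ F(S(1) ⊕ ⋯ ⊕ S(i))`. (These `N` are closed
under intersections when `A` is a finite-dimensional algebra, so the infimum is one of them.) -/
def standardKernel (i : Fin n) : Submodule Aᵐᵒᵖ (P e i) :=
  sInf {N | FiltSet (S e) (Set.Iic i) (ModuleCat.of Aᵐᵒᵖ (P e i ⧸ N))}

/-- The standard module `Δ(i)`: the maximal factor module of `e i A` that lies in
`F(S(1) ⊕ ⋯ ⊕ S(i))`. -/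
abbrev standard (i : Fin n) : ModuleCat.{u} Aᵐᵒᵖ :=
  ModuleCat.of Aᵐᵒᵖ (P e i ⧸ standardKernel e i)

/-- The least submodule `N` of `Δ(i)` with `rad (Δ(i) / N) ∈ F(S(1) ⊕ ⋯ ⊕ S(i-1))`.
(Again the infimum is attained when `A` is a finite-dimensional algebra.) -/
def properStandardKernel (i : Fin n) : Submodule Aᵐᵒᵖ (standard e i) :=
  sInf {N | FiltSet (S e) (Set.Iio i)
    (ModuleCat.of Aᵐᵒᵖ (Module.jacobson Aᵐᵒᵖ (standard e i ⧸ N)))}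

/-- The proper standard module: the maximal factor module of `Δ(i)` whose radical lies in
`F(S(1) ⊕ ⋯ ⊕ S(i-1))`. -/
abbrev properStandard (i : Fin n) : ModuleCat.{u} Aᵐᵒᵖ :=
  ModuleCat.of Aᵐᵒᵖ (standard e i ⧸ properStandardKernel e i)

/-- `A` is a mixed stratified algebra with respect to `Θ`: the right module `A` lies in `F(Θ)` and
every `Θ i` is (isomorphic to) the `i`-th standard or the `i`-th proper standard module. -/
def IsMixedStratified (Θ : Fin n → ModuleCat.{u} Aᵐᵒᵖ) : Prop :=
  FiltSet Θ Set.univ (ModuleCat.of Aᵐᵒᵖ A) ∧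
    ∀ i, Nonempty (Θ i ≅ standard e i) ∨ Nonempty (Θ i ≅ properStandard e i)

end Algebra

end MixedStrat

/-! Everything is tested by maps out of the projectives `P e i` (written P(i) below): a finitely
generated module has no composition factor S(j) exactly when it receives no nonzero map from P(j),
so membership in F(S(s)) becomes a vanishing condition (`filtSet_S_iff`).

(1) implies (2). The top of the kernel of P(i) → Θ(i) involves only S(j) with j ≥ i
(`IsStandardCover`). Hence there are no maps and no extensions from Θ(i) to Θ(j) for j < i, the
standard modules are stones and the proper standard ones are bricks. For such a family F(Θ(s)) is
closed under direct summands (`ExtDirected.retractClosed`), so each P(i) lies in F(Θ). Filtrations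
can be reordered with large indices at the bottom (`filtSet_union`). As P(i) has no maps to Θ(j) for
j < i, it lies in F(Θ(≥ i)), and then so does the kernel of P(i) → Θ(i).

(2) implies (1). The conflations filter each P(i), hence A. A brick Θ(i) is hit surjectively by
every nonzero map from P(i), which gives mutually inverse factorizations with the proper standard
module up to length (`CoverData.iso_properStandard`). If Θ(i) has no self-extensions, then P(i) →
Δ(i) is a sum of maps through Θ(i); since Δ(i) is local, one map Θ(i) → Δ(i) is onto
(`CoverData.iso_standard`).

(2) implies (3). T(i) is built from Θ(i) by adding copies of Θ(i), then of the lower Θ(l) in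
descending order, until all Ext¹(Θ(l), T) vanish. For a stone it suffices to extend a finite
spanning set of maps out of the kernel. For a brick, nonsplit extensions are added one at a time;
the process stops because no map Θ(i) → M' leaves M, which bounds dim Hom(P(i), M'/M)
(`homDim_le_of_essential`). Finally the indecomposable summand containing Θ(i) is kept; it exists
because Θ(i) is local. -/

namespace MixedStrat

open CategoryTheory

/-! ### Short exact sequences and retracts of modules. -/

section Exactness

variable {R : Type u} [Ring R]
variable {X Y Z W K Q : Type u} [AddCommGroup X] [Module R X] [AddCommGroup Y] [Module R Y]
  [AddCommGroup Z] [Module R Z] [AddCommGroup W] [Module R W] [AddCommGroup K] [Module R K]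
  [AddCommGroup Q] [Module R Q]

/-- The linear maps `f` and `g` form a short exact sequence `0 → X → Y → Z → 0`. -/
structure IsSES (f : X →ₗ[R] Y) (g : Y →ₗ[R] Z) : Prop where
  inj : Function.Injective f
  surj : Function.Surjective g
  exact : Function.Exact f g

lemma IsSES.comp_eq_zero {f : X →ₗ[R] Y} {g : Y →ₗ[R] Z} (h : IsSES f g) : g ∘ₗ f = 0 :=
  h.exact.linearMap_comp_eq_zero

lemma IsSES.apply_apply {f : X →ₗ[R] Y} {g : Y →ₗ[R] Z} (h : IsSES f g) (x : X) : g (f x) = 0 :=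
  h.exact.apply_apply_eq_zero x

lemma isSES_submodule (N : Submodule R Y) : IsSES N.subtype N.mkQ :=
  ⟨N.injective_subtype, N.mkQ_surjective, LinearMap.exact_subtype_mkQ N⟩

lemma isSES_ker {g : Y →ₗ[R] Z} (hg : Function.Surjective g) :
    IsSES (LinearMap.ker g).subtype g :=
  ⟨Submodule.injective_subtype _, hg, LinearMap.exact_subtype_ker_map g⟩

lemma isSES_range {f : X →ₗ[R] Y} (hf : Function.Injective f) :
    IsSES f (LinearMap.range f).mkQ :=
  ⟨hf, Submodule.mkQ_surjective _, by
    rw [LinearMap.exact_iff]; simp⟩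

lemma IsSES.shortExact {X Y Z : ModuleCat.{u} R} {f : X ⟶ Y} {g : Y ⟶ Z}
    (h : IsSES f.hom g.hom) (w : f ≫ g = 0) : (ShortComplex.mk f g w).ShortExact where
  exact := (ShortComplex.ShortExact.moduleCat_exact_iff_function_exact _).mpr h.exact
  mono_f := (ModuleCat.mono_iff_injective f).mpr h.inj
  epi_g := (ModuleCat.epi_iff_surjective g).mpr h.surj

lemma isSES_of_shortExact {X Y Z : ModuleCat.{u} R} {f : X ⟶ Y} {g : Y ⟶ Z} {w : f ≫ g = 0}
    (h : (ShortComplex.mk f g w).ShortExact) : IsSES f.hom g.hom :=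
  ⟨h.moduleCat_injective_f, h.moduleCat_surjective_g,
    (ShortComplex.ShortExact.moduleCat_exact_iff_function_exact _).mp h.exact⟩

lemma IsSES.shortExact_ofHom {f : X →ₗ[R] Y} {g : Y →ₗ[R] Z} (h : IsSES f g) :
    (ShortComplex.mk (ModuleCat.ofHom f) (ModuleCat.ofHom g)
      (by rw [← ModuleCat.ofHom_comp, h.comp_eq_zero]; rfl)).ShortExact :=
  IsSES.shortExact (f := ModuleCat.ofHom f) (g := ModuleCat.ofHom g) h _

/-- A map that vanishes on the kernel of a surjection factors through it. -/
lemma exists_factor {g : Y →ₗ[R] Z} (hg : Function.Surjective g) (h : Y →ₗ[R] W)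
    (hk : ∀ y, g y = 0 → h y = 0) : ∃ h' : Z →ₗ[R] W, h' ∘ₗ g = h := by
  let e := g.quotKerEquivOfSurjective hg
  refine ⟨(Submodule.liftQ _ h (fun y hy ↦ hk y (by simpa using hy))) ∘ₗ e.symm.toLinearMap, ?_⟩
  ext y
  have : e.symm (g y) = Submodule.Quotient.mk y := by
    rw [LinearEquiv.symm_apply_eq]; rfl
  simp only [LinearMap.coe_comp, Function.comp_apply, LinearEquiv.coe_coe, this]
  rfl

lemma IsSES.exists_desc {f : X →ₗ[R] Y} {g : Y →ₗ[R] Z} (h : IsSES f g) (u : Y →ₗ[R] W)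
    (hu : u ∘ₗ f = 0) : ∃ u' : Z →ₗ[R] W, u' ∘ₗ g = u :=
  exists_factor h.surj u fun y hy ↦ by
    obtain ⟨x, rfl⟩ := (h.exact y).mp hy
    exact LinearMap.congr_fun hu x

/-- A map into the range of an injection factors through it. -/
lemma exists_cofactor {f : X →ₗ[R] Y} (hf : Function.Injective f) (h : W →ₗ[R] Y)
    (hr : ∀ w, h w ∈ LinearMap.range f) : ∃ h' : W →ₗ[R] X, f ∘ₗ h' = h := by
  let e := LinearEquiv.ofInjective f hf
  refine ⟨e.symm.toLinearMap ∘ₗ h.codRestrict _ hr, ?_⟩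
  ext w
  change f (e.symm ⟨h w, hr w⟩) = h w
  have := e.apply_symm_apply ⟨h w, hr w⟩
  exact congrArg Subtype.val this

lemma IsSES.exists_lift {f : X →ₗ[R] Y} {g : Y →ₗ[R] Z} (h : IsSES f g) (u : W →ₗ[R] Y)
    (hu : g ∘ₗ u = 0) : ∃ u' : W →ₗ[R] X, f ∘ₗ u' = u :=
  exists_cofactor h.inj u fun w ↦ (h.exact _).mp (LinearMap.congr_fun hu w)

lemma apply_of_comp_eq_id {s : X →ₗ[R] Y} {r : Y →ₗ[R] X} (h : r ∘ₗ s = LinearMap.id) (x : X) :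
    r (s x) = x := LinearMap.congr_fun h x

/-- `X` is a direct summand of `Y`. -/
def IsRetract (R : Type u) [Ring R] (X Y : Type u) [AddCommGroup X] [Module R X]
    [AddCommGroup Y] [Module R Y] : Prop :=
  ∃ (s : X →ₗ[R] Y) (r : Y →ₗ[R] X), r ∘ₗ s = LinearMap.id

lemma IsRetract.of_equiv (e : X ≃ₗ[R] Y) : IsRetract R X Y :=
  ⟨e.toLinearMap, e.symm.toLinearMap, by ext; simp⟩

lemma IsRetract.trans (h : IsRetract R X Y) (h' : IsRetract R Y Z) : IsRetract R X Z := by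
  obtain ⟨s, r, hr⟩ := h
  obtain ⟨s', r', hr'⟩ := h'
  refine ⟨s' ∘ₗ s, r ∘ₗ r', ?_⟩
  ext x
  change r (r' (s' (s x))) = x
  rw [apply_of_comp_eq_id hr', apply_of_comp_eq_id hr]

lemma IsSES.equiv_prod_of_retraction {f : X →ₗ[R] Y} {g : Y →ₗ[R] Z} (h : IsSES f g)
    {r : Y →ₗ[R] X} (hr : r ∘ₗ f = LinearMap.id) : Nonempty (Y ≃ₗ[R] (X × Z)) := by
  refine ⟨LinearEquiv.ofBijective (r.prod g) ⟨?_, ?_⟩⟩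
  · rw [injective_iff_map_eq_zero]
    intro y hy
    have hy1 : r y = 0 := congrArg Prod.fst hy
    obtain ⟨x, rfl⟩ := (h.exact y).mp (congrArg Prod.snd hy)
    rw [apply_of_comp_eq_id hr] at hy1
    rw [hy1, map_zero]
  · rintro ⟨x, z⟩
    obtain ⟨y, rfl⟩ := h.surj z
    refine ⟨y + f (x - r y), ?_⟩
    have := apply_of_comp_eq_id hr (x - r y)
    simp [-map_sub, this, h.apply_apply]

end Exactness

/-! ### Vanishing of Ext¹, expressed by extending and splitting maps. -/

section ExtVanish

variable {R : Type u} [Ring R]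

/-- `Ext¹(X, Y) = 0`. -/
def ExtVanish (R : Type u) [Ring R] (X Y : Type u) [AddCommGroup X] [Module R X]
    [AddCommGroup Y] [Module R Y] : Prop :=
  Subsingleton (Abelian.Ext.{u} (ModuleCat.of R X) (ModuleCat.of R Y) 1)

variable {X Y Z W K Q : Type u} [AddCommGroup X] [Module R X] [AddCommGroup Y] [Module R Y]
  [AddCommGroup Z] [Module R Z] [AddCommGroup W] [Module R W] [AddCommGroup K] [Module R K]
  [AddCommGroup Q] [Module R Q]

open Abelian

lemma ExtVanish.eq_zero (h : ExtVanish R X Y)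
    (x : Ext.{u} (ModuleCat.of R X) (ModuleCat.of R Y) 1) : x = 0 :=
  @Subsingleton.elim _ h x 0

lemma extVanish_of_projective [Module.Projective R Q] : ExtVanish R Q Y := by
  have : Projective (ModuleCat.of R Q) := (IsProjective.iff_projective Q).mp inferInstance
  exact subsingleton_of_forall_eq 0 Ext.eq_zero_of_projective

lemma ExtVanish.exists_extend (h : ExtVanish R X Y) {i : K →ₗ[R] W} {p : W →ₗ[R] X}
    (hip : IsSES i p) (f : K →ₗ[R] Y) : ∃ f' : W →ₗ[R] Y, f' ∘ₗ i = f := by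
  obtain ⟨x₂, hx₂⟩ := Ext.contravariant_sequence_exact₁ hip.shortExact_ofHom (ModuleCat.of R Y)
    (Ext.mk₀ (ModuleCat.ofHom f)) (n₁ := 1) rfl (h.eq_zero _)
  obtain ⟨g, rfl⟩ := (Ext.mk₀_bijective _ _).2 x₂
  rw [Ext.mk₀_comp_mk₀] at hx₂
  have := (Ext.mk₀_bijective _ _).1 hx₂
  exact ⟨g.hom, congrArg ModuleCat.Hom.hom this⟩

/-- For projective Q, Ext¹(X, Y) is the cokernel of the restriction Hom(Q, Y) → Hom(K, Y). This is
the criterion by which nearly all vanishing is proved. -/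
lemma extVanish_of_extend {i : K →ₗ[R] Q} {p : Q →ₗ[R] X} [Module.Projective R Q]
    (hip : IsSES i p) (H : ∀ f : K →ₗ[R] Y, ∃ f' : Q →ₗ[R] Y, f' ∘ₗ i = f) :
    ExtVanish R X Y := by
  refine subsingleton_of_forall_eq 0 fun x ↦ ?_
  obtain ⟨x₁, hx₁⟩ := Ext.contravariant_sequence_exact₃ hip.shortExact_ofHom (ModuleCat.of R Y)
    x ((extVanish_of_projective (R := R) (Q := Q)).eq_zero _) (n₀ := 0) rfl
  obtain ⟨g, rfl⟩ := (Ext.mk₀_bijective _ _).2 x₁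
  obtain ⟨f', hf'⟩ := H g.hom
  have hg : g = ModuleCat.ofHom i ≫ ModuleCat.ofHom f' := by
    ext1; exact hf'.symm
  rw [← hx₁, hg, ← Ext.mk₀_comp_mk₀, ← Ext.comp_assoc_of_second_deg_zero,
    hip.shortExact_ofHom.extClass_comp, Ext.zero_comp]

lemma ExtVanish.of_ses_right {f : X →ₗ[R] Y} {g : Y →ₗ[R] Z} (h : IsSES f g)
    (hX : ExtVanish R W X) (hZ : ExtVanish R W Z) : ExtVanish R W Y := by
  refine subsingleton_of_forall_eq 0 fun x ↦ ?_
  obtain ⟨x₁, rfl⟩ := Ext.covariant_sequence_exact₂ (ModuleCat.of R W) h.shortExact_ofHom x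
    (hZ.eq_zero _)
  rw [hX.eq_zero x₁, Ext.zero_comp]

lemma ExtVanish.of_ses_left {f : X →ₗ[R] Y} {g : Y →ₗ[R] Z} (h : IsSES f g)
    (hX : ExtVanish R X W) (hZ : ExtVanish R Z W) : ExtVanish R Y W := by
  refine subsingleton_of_forall_eq 0 fun x ↦ ?_
  obtain ⟨x₁, rfl⟩ := Ext.contravariant_sequence_exact₂ h.shortExact_ofHom (ModuleCat.of R W) x
    (hX.eq_zero _)
  rw [hZ.eq_zero x₁, Ext.comp_zero]

/-- If the identity of `X` is a sum of maps that factor through objects `Z j` with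
`Ext¹(Z j, Y) = 0`, then `Ext¹(X, Y) = 0`. -/
lemma ExtVanish.of_sum_left {ι : Type*} [Fintype ι] (Z : ι → ModuleCat.{u} R)
    (α : ∀ j, X →ₗ[R] Z j) (β : ∀ j, Z j →ₗ[R] X) (h : ∑ j, β j ∘ₗ α j = LinearMap.id)
    (hZ : ∀ j, ExtVanish R (Z j) Y) : ExtVanish R X Y := by
  refine subsingleton_of_forall_eq 0 fun x ↦ ?_
  have hid : 𝟙 (ModuleCat.of R X) = ∑ j, ModuleCat.ofHom (α j) ≫ ModuleCat.ofHom (β j) := by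
    ext1
    rw [ModuleCat.hom_sum, ModuleCat.hom_id, ← h]
    rfl
  rw [← Ext.mk₀_id_comp x, hid, Ext.mk₀_sum, Ext.sum_comp]
  refine Finset.sum_eq_zero fun j _ ↦ ?_
  rw [← Ext.mk₀_comp_mk₀_assoc, (hZ j).eq_zero (Ext.comp _ x _), Ext.comp_zero]

lemma ExtVanish.of_sum_right {ι : Type*} [Fintype ι] (Z : ι → ModuleCat.{u} R)
    (α : ∀ j, Y →ₗ[R] Z j) (β : ∀ j, Z j →ₗ[R] Y) (h : ∑ j, β j ∘ₗ α j = LinearMap.id)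
    (hZ : ∀ j, ExtVanish R X (Z j)) : ExtVanish R X Y := by
  refine subsingleton_of_forall_eq 0 fun x ↦ ?_
  have hid : 𝟙 (ModuleCat.of R Y) = ∑ j, ModuleCat.ofHom (α j) ≫ ModuleCat.ofHom (β j) := by
    ext1
    rw [ModuleCat.hom_sum, ModuleCat.hom_id, ← h]
    rfl
  rw [← Ext.comp_mk₀_id x, hid, Ext.mk₀_sum, Ext.comp_sum]
  refine Finset.sum_eq_zero fun j _ ↦ ?_
  rw [← Ext.mk₀_comp_mk₀, ← Ext.comp_assoc_of_second_deg_zero, (hZ j).eq_zero (Ext.comp x _ _),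
    Ext.zero_comp]

lemma ExtVanish.of_retract_right (h : IsRetract R Y Z) (hZ : ExtVanish R X Z) :
    ExtVanish R X Y := by
  obtain ⟨s, r, hr⟩ := h
  exact .of_sum_right (ι := Unit) (fun _ ↦ ModuleCat.of R Z) (fun _ ↦ s) (fun _ ↦ r)
    (by simpa using hr) fun _ ↦ hZ

/-- A sequence with vanishing extension group has a retraction of its first map. -/
lemma ExtVanish.exists_retraction (h : ExtVanish R Z X) {f : X →ₗ[R] Y} {g : Y →ₗ[R] Z}
    (hfg : IsSES f g) : ∃ r : Y →ₗ[R] X, r ∘ₗ f = LinearMap.id :=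
  h.exists_extend hfg LinearMap.id

/-- Pushout of a short exact sequence along a map out of its first term. -/
lemma IsSES.exists_pushout {i : K →ₗ[R] Q} {p : Q →ₗ[R] X} (hip : IsSES i p) (f : K →ₗ[R] Y) :
    ∃ (E : ModuleCat.{u} R) (j : Y →ₗ[R] E) (q : E →ₗ[R] X) (f' : Q →ₗ[R] E),
      IsSES j q ∧ f' ∘ₗ i = j ∘ₗ f ∧ q ∘ₗ f' = p := by
  let N : Submodule R (Y × Q) := LinearMap.range (f.prod (-i))
  let q₀ : (Y × Q) →ₗ[R] X := p ∘ₗ LinearMap.snd R Y Q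
  have hq₀ : N ≤ LinearMap.ker q₀ := by
    rintro _ ⟨k, rfl⟩
    simp [q₀, hip.apply_apply]
  refine ⟨ModuleCat.of R ((Y × Q) ⧸ N), N.mkQ ∘ₗ LinearMap.inl R Y Q, N.liftQ q₀ hq₀,
    N.mkQ ∘ₗ LinearMap.inr R Y Q, ⟨?_, ?_, ?_⟩, ?_, ?_⟩
  · rw [injective_iff_map_eq_zero]
    intro y hy
    obtain ⟨k, hk⟩ := (Submodule.Quotient.mk_eq_zero N).mp hy
    have h1 : f k = y := congrArg Prod.fst hk
    have h2 : -i k = 0 := congrArg Prod.snd hk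
    rw [← h1, (injective_iff_map_eq_zero i).mp hip.inj k (neg_eq_zero.mp h2), map_zero]
  · intro x
    obtain ⟨y, rfl⟩ := hip.surj x
    exact ⟨N.mkQ (0, y), by simp [q₀]⟩
  · intro e
    constructor
    · obtain ⟨⟨y, w⟩, rfl⟩ := N.mkQ_surjective e
      intro he
      have hw : p w = 0 := by simpa [q₀] using he
      obtain ⟨k, rfl⟩ := (hip.exact w).mp hw
      refine ⟨y + f k, ?_⟩
      refine (Submodule.Quotient.eq N).mpr ⟨k, ?_⟩
      simp
    · rintro ⟨y, rfl⟩
      simp [q₀]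
  · ext k
    refine (Submodule.Quotient.eq N).mpr ⟨-k, ?_⟩
    simp
  · ext w
    simp [q₀]

/-- If the pushout along f : K → Y has a section s, then f' - s ∘ p takes values in Y and extends f.
So if all extensions split, all maps K → Y extend to Q. -/
lemma exists_nonsplit_of_not_extVanish {i : K →ₗ[R] Q} {p : Q →ₗ[R] X} [Module.Projective R Q]
    (hip : IsSES i p) (h : ¬ ExtVanish R X Y) :
    ∃ (E : ModuleCat.{u} R) (j : Y →ₗ[R] E) (q : E →ₗ[R] X),
      IsSES j q ∧ ∀ s : X →ₗ[R] E, q ∘ₗ s ≠ LinearMap.id := by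
  by_contra! H
  refine h (extVanish_of_extend hip fun f ↦ ?_)
  obtain ⟨E, j, q, f', hjq, hf', hq⟩ := hip.exists_pushout f
  obtain ⟨s, hs⟩ := H E j q hjq
  obtain ⟨v, hv⟩ := hjq.exists_lift (f' - s ∘ₗ p) (by
    rw [LinearMap.comp_sub, ← LinearMap.comp_assoc, hs, hq, LinearMap.id_comp, sub_self])
  refine ⟨v, ?_⟩
  ext k
  apply hjq.inj
  have h1 := LinearMap.congr_fun hv (i k)
  have h2 := LinearMap.congr_fun hf' k
  simp only [LinearMap.coe_comp, Function.comp_apply, LinearMap.sub_apply, hip.apply_apply,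
    map_zero, sub_zero] at h1 h2 ⊢
  rw [h1, h2]

end ExtVanish

/-! ### Classes of modules closed under extensions or summands, and their products. -/

section Classes

variable {R : Type u} [Ring R]

/-- The class `𝒳` is closed under extensions. -/
def ExtClosed (𝒳 : ModuleCat.{u} R → Prop) : Prop :=
  ∀ ⦃X Y Z : ModuleCat.{u} R⦄ (f : X →ₗ[R] Y) (g : Y →ₗ[R] Z), IsSES f g → 𝒳 X → 𝒳 Z → 𝒳 Y

/-- The class `𝒳` is closed under direct summands. -/
def RetractClosed (𝒳 : ModuleCat.{u} R → Prop) : Prop :=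
  ∀ ⦃X Y : ModuleCat.{u} R⦄, IsRetract R X Y → 𝒳 Y → 𝒳 X

variable {X Y Z W : Type u} [AddCommGroup X] [Module R X] [AddCommGroup Y] [Module R Y]
  [AddCommGroup Z] [Module R Z] [AddCommGroup W] [Module R W]

lemma RetractClosed.of_equiv {𝒳 : ModuleCat.{u} R → Prop} (h : RetractClosed 𝒳) (e : X ≃ₗ[R] Y)
    (hX : 𝒳 (ModuleCat.of R X)) : 𝒳 (ModuleCat.of R Y) :=
  h (IsRetract.of_equiv e.symm) hX

lemma IsSES.ker_eq {f : X →ₗ[R] Y} {g : Y →ₗ[R] Z} (h : IsSES f g) :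
    LinearMap.ker g = LinearMap.range f := LinearMap.exact_iff.mp h.exact

/-- The quotient of the middle term of a short exact sequence by the first term. -/
noncomputable def IsSES.quotEquiv {f : X →ₗ[R] Y} {g : Y →ₗ[R] Z} (h : IsSES f g) :
    (Y ⧸ LinearMap.range f) ≃ₗ[R] Z :=
  (Submodule.quotEquivOfEq _ _ h.ker_eq.symm).trans (g.quotKerEquivOfSurjective h.surj)

lemma isSES_fin_cons {m : ℕ} (M : Fin (m + 1) → ModuleCat.{u} R) :
    IsSES (LinearMap.single R (fun i ↦ M i) 0)
      (LinearMap.pi fun i : Fin m ↦ LinearMap.proj (φ := fun i ↦ M i) i.succ) := by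
  refine ⟨fun x y h ↦ by simpa using congrFun h 0, fun y ↦ ⟨Fin.cons 0 y, ?_⟩, fun y ↦ ⟨fun h ↦ ?_, ?_⟩⟩
  · ext i; simp
  · refine ⟨y 0, ?_⟩
    ext i
    refine Fin.cases ?_ (fun j ↦ ?_) i
    · simp
    · have : y j.succ = 0 := congrFun h j
      simp [this]
  · rintro ⟨x, rfl⟩
    ext i
    simp

lemma ExtClosed.pi {𝒳 : ModuleCat.{u} R → Prop} (h : ExtClosed 𝒳)
    (h0 : ∀ X : ModuleCat.{u} R, Subsingleton X → 𝒳 X) {m : ℕ} (M : Fin m → ModuleCat.{u} R)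
    (hM : ∀ i, 𝒳 (M i)) : 𝒳 (ModuleCat.of R (∀ i, M i)) := by
  induction m with
  | zero => exact h0 _ inferInstance
  | succ m ih =>
    exact h (X := M 0) (Y := ModuleCat.of R (∀ i, M i)) (Z := ModuleCat.of R (∀ i : Fin m, M i.succ))
      _ _ (isSES_fin_cons M) (hM 0) (ih _ fun i ↦ hM i.succ)

/-- The class of all extensions of modules in `𝒴` by modules in `𝒳`. -/
def Star (𝒳 𝒴 : ModuleCat.{u} R → Prop) (Y : ModuleCat.{u} R) : Prop :=
  ∃ N : Submodule R Y, 𝒳 (ModuleCat.of R N) ∧ 𝒴 (ModuleCat.of R (Y ⧸ N))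

variable {𝒳 𝒴 : ModuleCat.{u} R → Prop}

lemma star_of_isSES (h𝒳 : RetractClosed 𝒳) (h𝒴 : RetractClosed 𝒴) {f : X →ₗ[R] Y} {g : Y →ₗ[R] Z}
    (h : IsSES f g) (hX : 𝒳 (ModuleCat.of R X)) (hZ : 𝒴 (ModuleCat.of R Z)) :
    Star 𝒳 𝒴 (ModuleCat.of R Y) :=
  ⟨LinearMap.range f, h𝒳.of_equiv (LinearEquiv.ofInjective f h.inj) hX,
    h𝒴.of_equiv h.quotEquiv.symm hZ⟩

/-- Since Hom(𝒳, 𝒴) = 0, the idempotent s ∘ r of Y preserves the submodule N, so both the sub and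
the quotient split along with Y. -/
lemma retractClosed_star (h𝒳 : RetractClosed 𝒳) (h𝒴 : RetractClosed 𝒴)
    (hhom : ∀ X Y : ModuleCat.{u} R, 𝒳 X → 𝒴 Y → ∀ f : X →ₗ[R] Y, f = 0) :
    RetractClosed (Star 𝒳 𝒴) := by
  rintro X Y ⟨s, r, hr⟩ ⟨N, hN, hQ⟩
  have hr' := apply_of_comp_eq_id hr
  have hstab : ∀ y ∈ N, s (r y) ∈ N := fun y hy ↦ by
    have := LinearMap.congr_fun (hhom _ _ hN hQ (N.mkQ ∘ₗ s ∘ₗ r ∘ₗ N.subtype)) ⟨y, hy⟩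
    exact (Submodule.Quotient.mk_eq_zero N).mp this
  refine ⟨N.comap s, h𝒳 ⟨s.restrict fun x hx ↦ hx, r.restrict fun y hy ↦ hstab y hy, ?_⟩ hN,
    h𝒴 ⟨(N.comap s).mapQ N s le_rfl, N.mapQ (N.comap s) r fun y hy ↦ hstab y hy, ?_⟩ hQ⟩
  · ext x
    exact hr' x
  · ext x
    exact congrArg (Submodule.Quotient.mk (p := N.comap s)) (hr' x)

/-- The layers of Y are 𝒳, 𝒴, 𝒳, 𝒴 from the bottom. Vanishing of Ext¹(𝒳, 𝒴) allows the two middle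
layers to be exchanged. -/
lemma extClosed_star (h𝒳' : ExtClosed 𝒳) (h𝒴' : ExtClosed 𝒴)
    (hext : ∀ X Y : ModuleCat.{u} R, 𝒳 X → 𝒴 Y → ExtVanish R X Y) :
    ExtClosed (Star 𝒳 𝒴) := by
  rintro Y₁ Y Y₂ f g hfg ⟨N₁, hN₁, hQ₁⟩ ⟨N₂, hN₂, hQ₂⟩
  let B : Submodule R Y := N₂.comap g
  let i : Y₁ →ₗ[R] B := f.codRestrict B fun x ↦ by simp [B, hfg.apply_apply]
  let p : B →ₗ[R] N₂ := g.restrict fun x hx ↦ hx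
  have hip : IsSES i p := by
    refine ⟨fun a b hab ↦ hfg.inj (congrArg Subtype.val hab), ?_, ?_⟩
    · rintro ⟨z, hz⟩
      obtain ⟨y, rfl⟩ := hfg.surj z
      exact ⟨⟨y, hz⟩, rfl⟩
    · rintro ⟨y, hy⟩
      constructor
      · intro h
        obtain ⟨x, rfl⟩ := (hfg.exact y).mp (congrArg Subtype.val h)
        exact ⟨x, rfl⟩
      · rintro ⟨x, hx⟩
        rw [← hx]
        exact Subtype.ext (hfg.apply_apply x)
  -- The exchange: B is an extension of N₂ by Y₁, and Y₁ → Y₁/N₁ extends to B. The kernel of the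
  -- extended map is an extension of N₂ by N₁.
  obtain ⟨φ, hφ⟩ := (hext _ _ hN₂ hQ₁).exists_extend hip N₁.mkQ
  have hφ' : ∀ x, φ (i x) = N₁.mkQ x := LinearMap.congr_fun hφ
  let N : Submodule R Y := (LinearMap.ker φ).map B.subtype
  have hNB : ∀ y (hy : y ∈ B), y ∈ N ↔ φ ⟨y, hy⟩ = 0 := fun y hy ↦ by
    constructor
    · rintro ⟨b, hb, rfl⟩
      exact hb
    · intro h
      exact ⟨⟨y, hy⟩, h, rfl⟩
  have hfN : ∀ x, f x ∈ N ↔ x ∈ N₁ := fun x ↦ by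
    rw [hNB (f x) (i x).2]
    exact (iff_of_eq (congrArg (· = 0) (hφ' x))).trans (Submodule.Quotient.mk_eq_zero N₁)
  have hNle : N ≤ B := Submodule.map_subtype_le _ _
  have hcorr : ∀ y ∈ B, ∃ x, y - f x ∈ N := fun y hy ↦ by
    obtain ⟨x, hx⟩ := N₁.mkQ_surjective (φ ⟨y, hy⟩)
    refine ⟨x, (hNB _ (B.sub_mem hy (i x).2)).mpr ?_⟩
    change φ (⟨y, hy⟩ - i x) = 0
    rw [map_sub, hφ', hx, sub_self]
  refine ⟨N, ?_, ?_⟩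
  · refine h𝒳' (X := ModuleCat.of R N₁) (Z := ModuleCat.of R N₂)
      (f.restrict fun x hx ↦ (hfN x).mpr hx) (g.restrict fun y hy ↦ hNle hy) ⟨?_, ?_, ?_⟩ hN₁ hN₂
    · exact fun a b hab ↦ Subtype.ext (hfg.inj (congrArg Subtype.val hab))
    · rintro ⟨z, hz⟩
      obtain ⟨y, rfl⟩ := hfg.surj z
      obtain ⟨x, hx⟩ := hcorr y hz
      refine ⟨⟨_, hx⟩, Subtype.ext ?_⟩
      simp [hfg.apply_apply]
    · rintro ⟨y, hy⟩
      constructor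
      · intro h
        obtain ⟨x, rfl⟩ := (hfg.exact y).mp (congrArg Subtype.val h)
        exact ⟨⟨x, (hfN x).mp hy⟩, rfl⟩
      · rintro ⟨x, hx⟩
        rw [← hx]
        exact Subtype.ext (hfg.apply_apply x.1)
  · refine h𝒴' (X := ModuleCat.of R (Y₁ ⧸ N₁)) (Z := ModuleCat.of R (Y₂ ⧸ N₂))
      (N₁.mapQ N f fun x hx ↦ (hfN x).mpr hx) (N.mapQ N₂ g hNle) ⟨?_, ?_, ?_⟩ hQ₁ hQ₂
    · rw [injective_iff_map_eq_zero]
      intro x hx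
      obtain ⟨x, rfl⟩ := N₁.mkQ_surjective x
      exact (Submodule.Quotient.mk_eq_zero N₁).mpr
        ((hfN x).mp ((Submodule.Quotient.mk_eq_zero N).mp hx))
    · intro z
      obtain ⟨z, rfl⟩ := N₂.mkQ_surjective z
      obtain ⟨y, rfl⟩ := hfg.surj z
      exact ⟨N.mkQ y, rfl⟩
    · intro y
      obtain ⟨y, rfl⟩ := N.mkQ_surjective y
      constructor
      · intro h
        obtain ⟨x, hx⟩ := hcorr y ((Submodule.Quotient.mk_eq_zero N₂).mp h)
        refine ⟨N₁.mkQ x, ?_⟩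
        refine ((Submodule.Quotient.eq N).mpr ?_)
        rw [← neg_sub]
        exact N.neg_mem hx
      · rintro ⟨x, hx⟩
        rw [← hx]
        obtain ⟨x, rfl⟩ := N₁.mkQ_surjective x
        exact (Submodule.Quotient.mk_eq_zero N₂).mpr (by rw [hfg.apply_apply]; exact N₂.zero_mem)

end Classes

/-! ### The classes F(Θ(s)): extensions, Hom and Ext vanishing, reordering of filtrations. -/

section Filtrations

variable {R : Type u} [Ring R] {M M' : ModuleCat.{u} R}

lemma inAdd_iff {X : ModuleCat.{u} R} : InAdd M X ↔ ∃ m : ℕ, IsRetract R X (Fin m → M) := Iff.rfl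

lemma retractClosed_inAdd (M : ModuleCat.{u} R) : RetractClosed (InAdd M) := by
  rintro X Y h ⟨m, hm⟩
  exact ⟨m, h.trans hm⟩

lemma InAdd.of_subsingleton (X : ModuleCat.{u} R) [Subsingleton X] : InAdd M X :=
  ⟨0, 0, 0, by ext; exact Subsingleton.elim _ _⟩

lemma inAdd_self (M : ModuleCat.{u} R) : InAdd M M :=
  ⟨1, LinearMap.pi fun _ ↦ LinearMap.id, LinearMap.proj 0, by ext; simp⟩

lemma InAdd.of_isRetract (h : IsRetract R M M') {X : ModuleCat.{u} R} (hX : InAdd M X) :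
    InAdd M' X := by
  obtain ⟨s, r, hr⟩ := h
  obtain ⟨m, hm⟩ := inAdd_iff.mp hX
  refine ⟨m, hm.trans ⟨s.compLeft (Fin m), r.compLeft (Fin m), ?_⟩⟩
  exact LinearMap.ext fun x ↦ funext fun i ↦ apply_of_comp_eq_id hr _

lemma Filt.of_subsingleton (X : ModuleCat.{u} R) [Subsingleton X] : Filt M X :=
  .of_inAdd (.of_subsingleton X)

lemma Filt.of_isSES_inAdd {X Y Z : ModuleCat.{u} R} {f : X →ₗ[R] Y} {g : Y →ₗ[R] Z}
    (h : IsSES f g) (hX : Filt M X) (hZ : InAdd M Z) : Filt M Y :=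
  .ext (ModuleCat.ofHom f) (ModuleCat.ofHom g) _ h.shortExact_ofHom hX hZ

/-- `Filt` only adds a factor at the top, so the induction runs over the filtration of the quotient
Z. -/
lemma extClosed_filt (M : ModuleCat.{u} R) : ExtClosed (Filt M) := by
  intro X Y Z f g hfg hX hZ
  induction hZ generalizing Y with
  | of_inAdd h => exact .of_isSES_inAdd hfg hX h
  | @ext Z₁ Z Z₂ a b w hex _ hZ₂ ih =>
    have hab := isSES_of_shortExact hex
    -- The preimage in Y of the lower part Z₁ of Z. It is an extension of Z₁ by X, and Y/B is the
    -- top factor Z₂.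
    let B : Submodule R Y := LinearMap.ker (b.hom ∘ₗ g)
    have hB : IsSES B.subtype (b.hom ∘ₗ g) := isSES_ker (hab.surj.comp hfg.surj)
    obtain ⟨p, hp⟩ := hab.exists_lift (g ∘ₗ B.subtype) (by ext x; exact x.2)
    have hp' : ∀ x : B, a.hom (p x) = g x := LinearMap.congr_fun hp
    let i : X →ₗ[R] B := f.codRestrict B fun x ↦ by simp [B, hfg.apply_apply]
    refine .of_isSES_inAdd (X := ModuleCat.of R B) hB (ih i p ⟨?_, ?_, ?_⟩) hZ₂
    · exact fun x y hxy ↦ hfg.inj (congrArg Subtype.val hxy)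
    · intro z
      obtain ⟨y, hy⟩ := hfg.surj (a.hom z)
      refine ⟨⟨y, ?_⟩, hab.inj ?_⟩
      · change b.hom (g y) = 0
        rw [hy, hab.apply_apply]
      · rw [hp', hy]
    · intro y
      constructor
      · intro h
        obtain ⟨x, hx⟩ := (hfg.exact y.1).mp (by rw [← hp', h, map_zero])
        exact ⟨x, Subtype.ext hx⟩
      · rintro ⟨x, rfl⟩
        apply hab.inj
        rw [hp', map_zero]
        exact hfg.apply_apply x

lemma Filt.of_equiv {X Y : ModuleCat.{u} R} (e : X ≃ₗ[R] Y) (hX : Filt M X) : Filt M Y :=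
  extClosed_filt M (Z := ModuleCat.of R PUnit) e.toLinearMap 0
    ⟨e.injective, fun _ ↦ ⟨0, rfl⟩, fun y ↦ ⟨fun _ ↦ ⟨e.symm y, by simp⟩, fun _ ↦ rfl⟩⟩
    hX (.of_subsingleton _)

lemma Filt.mono (h : ∀ X, InAdd M X → InAdd M' X) {X : ModuleCat.{u} R} (hX : Filt M X) :
    Filt M' X := by
  induction hX with
  | of_inAdd h' => exact .of_inAdd (h _ h')
  | ext f g w hex _ hZ ih => exact .ext f g w hex ih (h _ hZ)

variable {t : ℕ} (Θ : Fin t → ModuleCat.{u} R)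

open Classical in
lemma isRetract_dsum {s s' : Set (Fin t)} (h : s ⊆ s') :
    IsRetract R (dsum Θ s) (dsum Θ s') := by
  refine ⟨LinearMap.pi fun j : s' ↦ if hj : j.1 ∈ s then
      LinearMap.proj (φ := fun j : s ↦ Θ j) ⟨j.1, hj⟩ else 0,
    LinearMap.pi fun j : s ↦ LinearMap.proj (φ := fun j : s' ↦ Θ j) ⟨j.1, h j.2⟩, ?_⟩
  ext x j
  simp

variable {Θ}

lemma FiltSet.mono {s s' : Set (Fin t)} (h : s ⊆ s') {X : ModuleCat.{u} R}
    (hX : FiltSet Θ s X) : FiltSet Θ s' X :=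
  Filt.mono (fun _ ↦ InAdd.of_isRetract (isRetract_dsum Θ h)) hX

lemma isRetract_dsum_of_mem (Θ : Fin t → ModuleCat.{u} R) {s : Set (Fin t)} {j : Fin t}
    (hj : j ∈ s) : IsRetract R (Θ j) (dsum Θ s) := by
  classical
  exact ⟨LinearMap.single R (fun j : s ↦ Θ j) ⟨j, hj⟩, LinearMap.proj (φ := fun j : s ↦ Θ j) ⟨j, hj⟩,
    by ext x; simp⟩

lemma inAdd_dsum_of_mem (Θ : Fin t → ModuleCat.{u} R) {s : Set (Fin t)} {j : Fin t}
    (hj : j ∈ s) : InAdd (dsum Θ s) (Θ j) :=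
  (inAdd_self _).of_isRetract (isRetract_dsum_of_mem Θ hj)

lemma filtSet_of_mem (Θ : Fin t → ModuleCat.{u} R) {s : Set (Fin t)} {j : Fin t}
    (hj : j ∈ s) : FiltSet Θ s (Θ j) := .of_inAdd (inAdd_dsum_of_mem Θ hj)

/-- The identity of a module in `add (⨁_{j ∈ s} Θ j)` is a sum of maps through the `Θ j`. -/
lemma InAdd.exists_sum {s : Set (Fin t)} {X : ModuleCat.{u} R} (h : InAdd (dsum Θ s) X) :
    ∃ (ι : Type) (_ : Fintype ι) (c : ι → s) (α : ∀ l, X →ₗ[R] Θ (c l))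
      (β : ∀ l, Θ (c l) →ₗ[R] X), ∑ l, β l ∘ₗ α l = LinearMap.id := by
  classical
  obtain ⟨m, σ, ρ, hρ⟩ := h
  have : Fintype s := Fintype.ofFinite s
  refine ⟨Fin m × s, inferInstance, fun l ↦ l.2,
    fun l ↦ LinearMap.proj (φ := fun j : s ↦ Θ j) l.2 ∘ₗ LinearMap.proj l.1 ∘ₗ σ,
    fun l ↦ ρ ∘ₗ LinearMap.single R (fun _ : Fin m ↦ dsum Θ s) l.1 ∘ₗ
      LinearMap.single R (fun j : s ↦ Θ j) l.2, ?_⟩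
  ext x
  rw [LinearMap.sum_apply, Fintype.sum_prod_type]
  have h1 : σ x = ∑ i : Fin m, ∑ j : s, Pi.single i (Pi.single j (σ x i j)) := by
    ext i j
    simp only [Finset.sum_apply]
    rw [Finset.sum_eq_single i, Finset.sum_eq_single j]
    · simp
    · intro b _ hb
      rw [Pi.single_eq_same, Pi.single_eq_of_ne hb.symm]
    · simp
    · intro b _ hb
      refine Finset.sum_eq_zero fun c _ ↦ ?_
      rw [Pi.single_eq_of_ne hb.symm]
      rfl
    · simp
  conv_rhs => rw [LinearMap.id_apply, ← apply_of_comp_eq_id hρ x, h1]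
  simp only [map_sum]
  rfl

lemma InAdd.exists_comp_ne_zero {s : Set (Fin t)} {X W : ModuleCat.{u} R}
    (h : InAdd (dsum Θ s) X) (f : X →ₗ[R] W) (hf : f ≠ 0) :
    ∃ j ∈ s, ∃ β : Θ j →ₗ[R] X, f ∘ₗ β ≠ 0 := by
  obtain ⟨ι, _, c, α, β, hαβ⟩ := h.exists_sum
  by_contra! H
  refine hf ?_
  ext x
  rw [← LinearMap.id_apply (R := R) x, ← hαβ, LinearMap.sum_apply, map_sum]
  exact Finset.sum_eq_zero fun l _ ↦ LinearMap.congr_fun (H _ (c l).2 (β l)) (α l x)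

lemma InAdd.exists_comp_ne_zero' {s : Set (Fin t)} {X W : ModuleCat.{u} R}
    (h : InAdd (dsum Θ s) X) (f : W →ₗ[R] X) (hf : f ≠ 0) :
    ∃ j ∈ s, ∃ α : X →ₗ[R] Θ j, α ∘ₗ f ≠ 0 := by
  obtain ⟨ι, _, c, α, β, hαβ⟩ := h.exists_sum
  by_contra! H
  refine hf ?_
  ext x
  rw [← LinearMap.id_apply (R := R) (f x), ← hαβ, LinearMap.sum_apply]
  refine Finset.sum_eq_zero fun l _ ↦ ?_
  exact (congrArg (β l) (LinearMap.congr_fun (H _ (c l).2 (α l)) x)).trans (map_zero _)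

lemma FiltSet.hom_eq_zero {s : Set (Fin t)} {X W : ModuleCat.{u} R} (h : FiltSet Θ s X)
    (H : ∀ j ∈ s, ∀ f : Θ j →ₗ[R] W, f = 0) (f : X →ₗ[R] W) : f = 0 := by
  induction h with
  | of_inAdd h =>
    by_contra hf
    obtain ⟨j, hj, β, hβ⟩ := h.exists_comp_ne_zero f hf
    exact hβ (H j hj _)
  | ext a b w hex _ hZ ih =>
    obtain ⟨f', rfl⟩ := (isSES_of_shortExact hex).exists_desc f (ih _)
    by_contra hf
    obtain ⟨j, hj, β, hβ⟩ := hZ.exists_comp_ne_zero f' (by rintro rfl; exact hf rfl)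
    exact hβ (H j hj _)

lemma FiltSet.hom_eq_zero' {s : Set (Fin t)} {X W : ModuleCat.{u} R} (h : FiltSet Θ s X)
    (H : ∀ j ∈ s, ∀ f : W →ₗ[R] Θ j, f = 0) (f : W →ₗ[R] X) : f = 0 := by
  induction h with
  | of_inAdd h =>
    by_contra hf
    obtain ⟨j, hj, β, hβ⟩ := h.exists_comp_ne_zero' f hf
    exact hβ (H j hj _)
  | ext a b w hex _ hZ ih =>
    have : b.hom ∘ₗ f = 0 := by
      by_contra hf
      obtain ⟨j, hj, β, hβ⟩ := hZ.exists_comp_ne_zero' _ hf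
      exact hβ (H j hj _)
    obtain ⟨f', rfl⟩ := (isSES_of_shortExact hex).exists_lift f this
    rw [ih f', LinearMap.comp_zero]

lemma InAdd.extVanish_left {s : Set (Fin t)} {X W : ModuleCat.{u} R} (h : InAdd (dsum Θ s) X)
    (H : ∀ j ∈ s, ExtVanish R (Θ j) W) : ExtVanish R X W := by
  obtain ⟨ι, _, c, α, β, hαβ⟩ := h.exists_sum
  exact .of_sum_left (fun l ↦ Θ (c l)) α β hαβ fun l ↦ H _ (c l).2

lemma InAdd.extVanish_right {s : Set (Fin t)} {X W : ModuleCat.{u} R} (h : InAdd (dsum Θ s) X)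
    (H : ∀ j ∈ s, ExtVanish R W (Θ j)) : ExtVanish R W X := by
  obtain ⟨ι, _, c, α, β, hαβ⟩ := h.exists_sum
  exact .of_sum_right (fun l ↦ Θ (c l)) α β hαβ fun l ↦ H _ (c l).2

lemma FiltSet.extVanish_left {s : Set (Fin t)} {X W : ModuleCat.{u} R} (h : FiltSet Θ s X)
    (H : ∀ j ∈ s, ExtVanish R (Θ j) W) : ExtVanish R X W := by
  induction h with
  | of_inAdd h => exact h.extVanish_left H
  | ext a b w hex _ hZ ih => exact .of_ses_left (isSES_of_shortExact hex) ih (hZ.extVanish_left H)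

lemma FiltSet.extVanish_right {s : Set (Fin t)} {X W : ModuleCat.{u} R} (h : FiltSet Θ s X)
    (H : ∀ j ∈ s, ExtVanish R W (Θ j)) : ExtVanish R W X := by
  induction h with
  | of_inAdd h => exact h.extVanish_right H
  | ext a b w hex _ hZ ih =>
    exact .of_ses_right (isSES_of_shortExact hex) ih (hZ.extVanish_right H)

lemma IsSES.finite {X Y Z : Type u} [AddCommGroup X] [Module R X] [AddCommGroup Y] [Module R Y]
    [AddCommGroup Z] [Module R Z] {f : X →ₗ[R] Y} {g : Y →ₗ[R] Z} (h : IsSES f g)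
    [Module.Finite R X] [Module.Finite R Z] : Module.Finite R Y := by
  have : Module.Finite R (LinearMap.range f) := .of_surjective _ f.surjective_rangeRestrict
  have : Module.Finite R (Y ⧸ LinearMap.range f) := .equiv h.quotEquiv.symm
  exact .of_submodule_quotient (LinearMap.range f)

lemma IsRetract.finite {X Y : Type u} [AddCommGroup X] [Module R X] [AddCommGroup Y] [Module R Y]
    (h : IsRetract R X Y) [Module.Finite R Y] : Module.Finite R X := by
  obtain ⟨s, r, hr⟩ := h
  exact .of_surjective r fun x ↦ ⟨s x, apply_of_comp_eq_id hr x⟩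

lemma InAdd.finite {s : Set (Fin t)} {X : ModuleCat.{u} R} (h : InAdd (dsum Θ s) X)
    (H : ∀ j ∈ s, Module.Finite R (Θ j)) : Module.Finite R X := by
  obtain ⟨m, hm⟩ := inAdd_iff.mp h
  have (j : s) : Module.Finite R (Θ j) := H j j.2
  have : Module.Finite R (dsum Θ s) := Module.Finite.pi
  exact hm.finite

lemma FiltSet.finite {s : Set (Fin t)} {X : ModuleCat.{u} R} (h : FiltSet Θ s X)
    (H : ∀ j ∈ s, Module.Finite R (Θ j)) : Module.Finite R X := by
  induction h with
  | of_inAdd h => exact h.finite H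
  | ext a b w hex _ hZ ih =>
    have := hZ.finite H
    exact (isSES_of_shortExact hex).finite

open Classical in
lemma isSES_dsum_union (Θ : Fin t → ModuleCat.{u} R) {a b : Set (Fin t)} (hab : Disjoint a b) :
    ∃ (f : dsum Θ a →ₗ[R] dsum Θ (a ∪ b)) (g : dsum Θ (a ∪ b) →ₗ[R] dsum Θ b), IsSES f g := by
  refine ⟨LinearMap.pi fun j ↦ if hj : j.1 ∈ a then
      LinearMap.proj (φ := fun j : a ↦ Θ j) ⟨j.1, hj⟩ else 0,
    LinearMap.pi fun j ↦ LinearMap.proj (φ := fun j : ↑(a ∪ b) ↦ Θ j) ⟨j.1, .inr j.2⟩, ?_, ?_, ?_⟩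
  · intro x y hxy
    ext j
    have := congrFun hxy ⟨j.1, .inl j.2⟩
    simpa using this
  · intro y
    refine ⟨fun j ↦ if hj : j.1 ∈ b then y ⟨j.1, hj⟩ else 0, ?_⟩
    ext j
    simp
  · intro y
    constructor
    · intro h
      refine ⟨fun j ↦ y ⟨j.1, .inl j.2⟩, ?_⟩
      ext ⟨j, hj⟩
      by_cases hja : j ∈ a
      · simp [hja]
      · have : y ⟨j, hj⟩ = 0 := congrFun h ⟨j, hj.resolve_left hja⟩
        simp [hja, this]
    · rintro ⟨x, rfl⟩
      ext j
      have : j.1 ∉ a := fun h ↦ Set.disjoint_left.mp hab h j.2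
      simp only [LinearMap.pi_apply, LinearMap.proj_apply, dif_neg this]
      rfl

/-- If there are neither maps nor extensions from `Θ(a)` to `Θ(b)`, then the modules in
`F(Θ(a ∪ b))` are the extensions of modules in `F(Θ(b))` by modules in `F(Θ(a))`. -/
lemma filtSet_union {a b : Set (Fin t)} (hab : Disjoint a b)
    (hhom : ∀ i ∈ a, ∀ j ∈ b, ∀ f : Θ i →ₗ[R] Θ j, f = 0)
    (hext : ∀ i ∈ a, ∀ j ∈ b, ExtVanish R (Θ i) (Θ j))
    (ha : RetractClosed (FiltSet Θ a)) (hb : RetractClosed (FiltSet Θ b)) :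
    FiltSet Θ (a ∪ b) = Star (FiltSet Θ a) (FiltSet Θ b) := by
  have hhom' : ∀ X Y : ModuleCat.{u} R, FiltSet Θ a X → FiltSet Θ b Y → ∀ f : X →ₗ[R] Y, f = 0 :=
    fun X Y hX hY ↦ hX.hom_eq_zero fun i hi ↦ hY.hom_eq_zero' fun j hj ↦ hhom i hi j hj
  have hext' : ∀ X Y : ModuleCat.{u} R, FiltSet Θ a X → FiltSet Θ b Y → ExtVanish R X Y :=
    fun X Y hX hY ↦ hX.extVanish_left fun i hi ↦ hY.extVanish_right fun j hj ↦ hext i hi j hj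
  have hec := extClosed_star (extClosed_filt _) (extClosed_filt _) hext'
  have hrc := retractClosed_star ha hb hhom'
  have hadd : ∀ X, InAdd (dsum Θ (a ∪ b)) X → Star (FiltSet Θ a) (FiltSet Θ b) X := by
    intro X hX
    obtain ⟨m, hm⟩ := inAdd_iff.mp hX
    refine hrc hm (Y := ModuleCat.of R (Fin m → dsum Θ (a ∪ b))) (hec.pi ?_ _ fun _ ↦ ?_)
    · intro Y _
      exact ⟨⊥, .of_subsingleton _, .of_subsingleton _⟩
    · obtain ⟨f, g, hfg⟩ := isSES_dsum_union Θ hab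
      exact star_of_isSES ha hb hfg (.of_inAdd (inAdd_self _)) (.of_inAdd (inAdd_self _))
  ext X
  constructor
  · intro h
    induction h with
    | of_inAdd h => exact hadd _ h
    | ext f g w hex _ hZ ih => exact hec _ _ (isSES_of_shortExact hex) ih (hadd _ hZ)
  · rintro ⟨N, hN, hQ⟩
    exact extClosed_filt _ (X := ModuleCat.of R N) (Z := ModuleCat.of R (X ⧸ N)) _ _
      (isSES_submodule N) (hN.mono Set.subset_union_left) (hQ.mono Set.subset_union_right)

lemma retractClosed_filtSet_union {a b : Set (Fin t)} (hab : Disjoint a b)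
    (hhom : ∀ i ∈ a, ∀ j ∈ b, ∀ f : Θ i →ₗ[R] Θ j, f = 0)
    (hext : ∀ i ∈ a, ∀ j ∈ b, ExtVanish R (Θ i) (Θ j))
    (ha : RetractClosed (FiltSet Θ a)) (hb : RetractClosed (FiltSet Θ b)) :
    RetractClosed (FiltSet Θ (a ∪ b)) := by
  rw [filtSet_union hab hhom hext ha hb]
  exact retractClosed_star ha hb fun X Y hX hY ↦
    hX.hom_eq_zero fun i hi ↦ hY.hom_eq_zero' fun j hj ↦ hhom i hi j hj

end Filtrations

/-! ### Closure of F(Θ(s)) under direct summands. -/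

section SummandClosure

variable {R : Type u} [Ring R] {t : ℕ} {Θ : Fin t → ModuleCat.{u} R}

lemma IsBrick.exists_inverse {B : ModuleCat.{u} R} (hB : IsBrick B) {f : B →ₗ[R] B} (hf : f ≠ 0) :
    ∃ g : B →ₗ[R] B, g ∘ₗ f = LinearMap.id ∧ f ∘ₗ g = LinearMap.id := by
  obtain ⟨v, rfl⟩ := hB.2 f hf
  exact ⟨(v⁻¹ : (Module.End R B)ˣ).1, v.inv_mul, v.mul_inv⟩

lemma IsBrick.nontrivial {B : ModuleCat.{u} R} (hB : IsBrick B) : Nontrivial B := by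
  by_contra h
  rw [not_nontrivial_iff_subsingleton] at h
  have := hB.1
  exact not_subsingleton (Module.End R B) ⟨fun f g ↦ LinearMap.ext fun x ↦ Subsingleton.elim _ _⟩

lemma InAdd.exists_retraction {s : Set (Fin t)} {X : ModuleCat.{u} R} (h : InAdd (dsum Θ s) X)
    {i : Fin t} (hi : IsBrick (Θ i)) (hs : ∀ j ∈ s, j ≠ i → ∀ f : Θ i →ₗ[R] Θ j, f = 0)
    {f : Θ i →ₗ[R] X} (hf : f ≠ 0) : ∃ r : X →ₗ[R] Θ i, r ∘ₗ f = LinearMap.id := by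
  obtain ⟨j, hj, α, hα⟩ := h.exists_comp_ne_zero' f hf
  obtain rfl : j = i := by
    by_contra hji
    exact hα (hs j hj hji _)
  obtain ⟨g, hg, -⟩ := hi.exists_inverse hα
  exact ⟨g ∘ₗ α, hg⟩

lemma InAdd.exists_section {s : Set (Fin t)} {X : ModuleCat.{u} R} (h : InAdd (dsum Θ s) X)
    {i : Fin t} (hi : IsBrick (Θ i)) (hs : ∀ j ∈ s, j ≠ i → ∀ f : Θ j →ₗ[R] Θ i, f = 0)
    {f : X →ₗ[R] Θ i} (hf : f ≠ 0) : ∃ r : Θ i →ₗ[R] X, f ∘ₗ r = LinearMap.id := by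
  obtain ⟨j, hj, β, hβ⟩ := h.exists_comp_ne_zero f hf
  obtain rfl : j = i := by
    by_contra hji
    exact hβ (hs j hj hji _)
  obtain ⟨g, -, hg⟩ := hi.exists_inverse hβ
  exact ⟨β ∘ₗ g, hg⟩

/-- The kernel of a split epimorphism is a direct summand. -/
lemma isRetract_ker {X Y : Type u} [AddCommGroup X] [Module R X] [AddCommGroup Y] [Module R Y]
    {f : X →ₗ[R] Y} {r : Y →ₗ[R] X} (h : r ∘ₗ f = LinearMap.id) :
    IsRetract R (LinearMap.ker r) Y :=
  ⟨Submodule.subtype _, (LinearMap.id - f ∘ₗ r).codRestrict _ fun y ↦ by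
      simp [apply_of_comp_eq_id h], by
    ext ⟨y, hy⟩
    have : r y = 0 := hy
    simp [this]⟩

lemma IsRetract.quotient {X Y : Type u} [AddCommGroup X] [Module R X] [AddCommGroup Y] [Module R Y]
    {s : X →ₗ[R] Y} {r : Y →ₗ[R] X} (h : r ∘ₗ s = LinearMap.id) {N : Submodule R X}
    {N' : Submodule R Y} (hs : N ≤ N'.comap s) (hr : N' ≤ N.comap r) :
    IsRetract R (X ⧸ N) (Y ⧸ N') :=
  ⟨N.mapQ N' s hs, N'.mapQ N r hr, by
    ext x
    exact congrArg (Submodule.Quotient.mk (p := N)) (apply_of_comp_eq_id h x)⟩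

/-- In the class of modules filtered by a brick `B`, every nonzero map from `B` is injective with
cokernel in that class. -/
lemma FiltSet.quotient_of_brick {i : Fin t} (hi : IsBrick (Θ i)) {Y : ModuleCat.{u} R}
    (hY : FiltSet Θ {i} Y) {h : Θ i →ₗ[R] Y} (hh : h ≠ 0) :
    Function.Injective h ∧ FiltSet Θ {i} (ModuleCat.of R (Y ⧸ LinearMap.range h)) := by
  have hs : ∀ j ∈ ({i} : Set (Fin t)), j ≠ i → ∀ f : Θ i →ₗ[R] Θ j, f = 0 :=
    fun j hj hji ↦ absurd hj hji
  induction hY with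
  | @of_inAdd Y hY =>
    obtain ⟨r, hr⟩ := hY.exists_retraction hi hs hh
    have hr' := apply_of_comp_eq_id hr
    refine ⟨Function.LeftInverse.injective hr', .of_inAdd (retractClosed_inAdd _ ?_ hY)⟩
    refine ⟨(LinearMap.range h).liftQ (LinearMap.id - h ∘ₗ r) ?_, Submodule.mkQ _, ?_⟩
    · rintro _ ⟨x, rfl⟩
      simp [hr']
    · ext y
      refine (Submodule.Quotient.eq _).mpr ⟨-r y, ?_⟩
      simp
  | @ext X Y Z a b w hex hX hZ ih =>
    have hab := isSES_of_shortExact hex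
    -- Either h lands in the lower part X and induction applies, or the top factor Z detects h. In
    -- the second case h is split by r ∘ b, so its cokernel is the kernel of r ∘ b, an extension of
    -- the summand ker r of Z by X.
    by_cases hb : b.hom ∘ₗ h = 0
    · obtain ⟨h', rfl⟩ := hab.exists_lift h hb
      obtain ⟨hinj, hQ⟩ := ih (h := h') (by rintro rfl; exact hh (LinearMap.comp_zero _))
      refine ⟨hab.inj.comp hinj, ?_⟩
      have hle : LinearMap.range h' ≤ (LinearMap.range (a.hom ∘ₗ h')).comap a.hom := by
        rintro _ ⟨x, rfl⟩
        exact ⟨x, rfl⟩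
      have hle' : LinearMap.range (a.hom ∘ₗ h') ≤ LinearMap.ker b.hom := by
        rintro _ ⟨x, rfl⟩
        exact hab.apply_apply _
      refine .of_isSES_inAdd (Z := Z) (X := ModuleCat.of R (X ⧸ LinearMap.range h'))
        (Y := ModuleCat.of R (Y ⧸ LinearMap.range (a.hom ∘ₗ h')))
        (f := Submodule.mapQ _ _ a.hom hle) (g := Submodule.liftQ _ b.hom hle') ⟨?_, ?_, ?_⟩ hQ hZ
      · rw [injective_iff_map_eq_zero]
        intro x hx
        obtain ⟨x, rfl⟩ := Submodule.mkQ_surjective _ x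
        obtain ⟨z, hz⟩ := (Submodule.Quotient.mk_eq_zero _).mp hx
        exact (Submodule.Quotient.mk_eq_zero _).mpr ⟨z, hab.inj hz⟩
      · intro z
        obtain ⟨y, rfl⟩ := hab.surj z
        exact ⟨Submodule.mkQ _ y, rfl⟩
      · intro y
        obtain ⟨y, rfl⟩ := Submodule.mkQ_surjective _ y
        constructor
        · intro hy
          obtain ⟨x, rfl⟩ := (hab.exact y).mp hy
          exact ⟨Submodule.mkQ _ x, rfl⟩
        · rintro ⟨x, hx⟩
          rw [← hx]
          obtain ⟨x, rfl⟩ := Submodule.mkQ_surjective _ x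
          exact hab.apply_apply x
    · obtain ⟨r, hr⟩ := hZ.exists_retraction hi hs hb
      have hrh : (r ∘ₗ b.hom) ∘ₗ h = LinearMap.id := hr
      have hrh' : ∀ x, r (b.hom (h x)) = x := apply_of_comp_eq_id hrh
      refine ⟨Function.LeftInverse.injective (g := r ∘ₗ b.hom) hrh', ?_⟩
      have hK : FiltSet Θ {i} (ModuleCat.of R (LinearMap.ker (r ∘ₗ b.hom))) := by
        refine .of_isSES_inAdd (X := X) (Z := ModuleCat.of R (LinearMap.ker r))
          (f := a.hom.codRestrict _ fun x ↦ by simp [hab.apply_apply])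
          (g := b.hom.restrict fun y hy ↦ hy) ⟨?_, ?_, ?_⟩ hX
          (retractClosed_inAdd _ (isRetract_ker hr) hZ)
        · exact fun x y hxy ↦ hab.inj (congrArg Subtype.val hxy)
        · rintro ⟨z, hz⟩
          obtain ⟨y, rfl⟩ := hab.surj z
          exact ⟨⟨y, hz⟩, rfl⟩
        · rintro ⟨y, hy⟩
          constructor
          · intro h0
            obtain ⟨x, rfl⟩ := (hab.exact y).mp (congrArg Subtype.val h0)
            exact ⟨x, rfl⟩
          · rintro ⟨x, hx⟩
            rw [← hx]
            exact Subtype.ext (hab.apply_apply x)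
      have hses : IsSES h ((LinearMap.id - h ∘ₗ r ∘ₗ b.hom).codRestrict
          (LinearMap.ker (r ∘ₗ b.hom)) fun y ↦ by simp [hrh']) := by
        refine ⟨Function.LeftInverse.injective (g := r ∘ₗ b.hom) hrh', ?_, ?_⟩
        · rintro ⟨y, hy⟩
          refine ⟨y, Subtype.ext ?_⟩
          have : r (b.hom y) = 0 := hy
          simp [this]
        · intro y
          constructor
          · intro hy
            have : y - h (r (b.hom y)) = 0 := congrArg Subtype.val hy
            exact ⟨r (b.hom y), (sub_eq_zero.mp this).symm⟩
          · rintro ⟨x, rfl⟩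
            refine Subtype.ext ?_
            simp [hrh']
      exact hK.of_equiv hses.quotEquiv.symm

/-- Among the modules filtered by `Θ(≥ i)`, every nonzero map to a brick `Θ i` is surjective with
kernel in that class. -/
lemma FiltSet.ker_of_brick {i : Fin t} (hi : IsBrick (Θ i)) {s : Set (Fin t)}
    (hs : ∀ j ∈ s, j ≠ i → ∀ f : Θ j →ₗ[R] Θ i, f = 0) {Y : ModuleCat.{u} R}
    (hY : FiltSet Θ s Y) {h : Y →ₗ[R] Θ i} (hh : h ≠ 0) :
    Function.Surjective h ∧ FiltSet Θ s (ModuleCat.of R (LinearMap.ker h)) := by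
  induction hY with
  | @of_inAdd Y hY =>
    obtain ⟨r, hr⟩ := hY.exists_section hi hs hh
    exact ⟨Function.RightInverse.surjective (apply_of_comp_eq_id hr),
      .of_inAdd (retractClosed_inAdd _ (isRetract_ker hr) hY)⟩
  | @ext X Y Z a b w hex hX hZ ih =>
    have hab := isSES_of_shortExact hex
    -- Either h factors through the top factor, where it splits, or its restriction to X is already
    -- onto and ker h is an extension of Z by the kernel of that restriction.
    by_cases ha : h ∘ₗ a.hom = 0
    · obtain ⟨h', rfl⟩ := hab.exists_desc h ha
      obtain ⟨r, hr⟩ := hZ.exists_section hi hs (f := h') (by rintro rfl; exact hh rfl)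
      refine ⟨(Function.RightInverse.surjective (apply_of_comp_eq_id hr)).comp hab.surj, ?_⟩
      refine .of_isSES_inAdd (X := X) (Z := ModuleCat.of R (LinearMap.ker h'))
          (f := a.hom.codRestrict _ fun x ↦ by simp [hab.apply_apply])
          (g := b.hom.restrict fun y hy ↦ hy) ⟨?_, ?_, ?_⟩ hX
          (retractClosed_inAdd _ (isRetract_ker hr) hZ)
      · exact fun x y hxy ↦ hab.inj (congrArg Subtype.val hxy)
      · rintro ⟨z, hz⟩
        obtain ⟨y, rfl⟩ := hab.surj z
        exact ⟨⟨y, hz⟩, rfl⟩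
      · rintro ⟨y, hy⟩
        constructor
        · intro h0
          obtain ⟨x, rfl⟩ := (hab.exact y).mp (congrArg Subtype.val h0)
          exact ⟨x, rfl⟩
        · rintro ⟨x, hx⟩
          rw [← hx]
          exact Subtype.ext (hab.apply_apply x)
    · obtain ⟨hsurj, hker⟩ := ih ha
      refine ⟨fun x ↦ (hsurj x).imp' a.hom fun _ ↦ id, ?_⟩
      refine .of_isSES_inAdd (X := ModuleCat.of R (LinearMap.ker (h ∘ₗ a.hom))) (Z := Z)
        (f := a.hom.restrict fun x hx ↦ hx) (g := b.hom ∘ₗ (LinearMap.ker h).subtype)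
        ⟨?_, ?_, ?_⟩ hker hZ
      · exact fun x y hxy ↦ Subtype.ext (hab.inj (congrArg Subtype.val hxy))
      · intro z
        obtain ⟨y, rfl⟩ := hab.surj z
        obtain ⟨x, hx⟩ := hsurj (h y)
        have hx' : h (a.hom x) = h y := hx
        refine ⟨⟨y - a.hom x, by simp [hx']⟩, ?_⟩
        simp [hab.apply_apply]
      · rintro ⟨y, hy⟩
        constructor
        · intro h0
          obtain ⟨x, rfl⟩ := (hab.exact y).mp h0
          exact ⟨⟨x, hy⟩, rfl⟩
        · rintro ⟨x, hx⟩
          rw [← hx]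
          exact hab.apply_apply x.1

lemma FiltSet.exists_ne_zero {s : Set (Fin t)} {X : ModuleCat.{u} R} (h : FiltSet Θ s X)
    [Nontrivial X] : ∃ j ∈ s, ∃ f : Θ j →ₗ[R] X, f ≠ 0 := by
  by_contra! H
  obtain ⟨x, hx⟩ := exists_ne (0 : X)
  exact hx (LinearMap.congr_fun (h.hom_eq_zero H LinearMap.id) x)

/-- Induction on the length of Y. A nonzero map from the brick to Y can be divided out inside the
class; the map is chosen so that the quotient of Y still has the wanted summand. -/
lemma retractClosed_of_brick [IsArtinianRing R] {i : Fin t} (hfin : Module.Finite R (Θ i))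
    (hi : IsBrick (Θ i)) : RetractClosed (FiltSet Θ {i}) := by
  intro X Y hXY hY
  induction hl : Module.length R Y using WellFoundedLT.induction generalizing X Y with
  | _ l ih =>
    have : Module.Finite R Y := hY.finite (by rintro j rfl; exact hfin)
    rcases subsingleton_or_nontrivial Y with hYs | hYn
    · obtain ⟨s, r, hr⟩ := hXY
      have : Subsingleton X := (Function.LeftInverse.injective (apply_of_comp_eq_id hr)).subsingleton
      exact .of_subsingleton _
    obtain ⟨j, rfl, h, hh⟩ := hY.exists_ne_zero
    obtain ⟨s, r, hr⟩ := hXY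
    have hr' := apply_of_comp_eq_id hr
    -- If r kills h, then X survives as a summand of Y / im h. Otherwise h is replaced by s ∘ r ∘ h,
    -- whose image lies in X, and X / im (r ∘ h) is a summand of the quotient.
    by_cases hrh : r ∘ₗ h = 0
    · obtain ⟨hinj, hQ⟩ := hY.quotient_of_brick hi hh
      refine ih _ ?_ ?_ hQ rfl
      · rw [← hl]
        exact Submodule.length_quotient_lt _ (by rwa [Ne, LinearMap.range_eq_bot])
      · have hle : LinearMap.range h ≤ LinearMap.ker r := by
          rintro _ ⟨x, rfl⟩
          exact LinearMap.congr_fun hrh x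
        exact ⟨Submodule.mkQ _ ∘ₗ s, Submodule.liftQ _ r hle, hr⟩
    · have hne : s ∘ₗ r ∘ₗ h ≠ 0 := fun h0 ↦ hrh <| by
        rw [← LinearMap.id_comp (r ∘ₗ h), ← hr, LinearMap.comp_assoc, h0, LinearMap.comp_zero]
      obtain ⟨hinj, hQ⟩ := hY.quotient_of_brick hi hne
      have hX : FiltSet Θ {j} (ModuleCat.of R (X ⧸ LinearMap.range (r ∘ₗ h))) := by
        refine ih _ ?_ ?_ hQ rfl
        · rw [← hl]
          exact Submodule.length_quotient_lt _ (by rwa [Ne, LinearMap.range_eq_bot])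
        · refine IsRetract.quotient hr ?_ ?_
          · rintro _ ⟨x, rfl⟩
            exact ⟨x, rfl⟩
          · rintro _ ⟨x, rfl⟩
            exact ⟨x, (hr' _).symm⟩
      have hinj' : Function.Injective (r ∘ₗ h) := fun x y hxy ↦ hinj (congrArg s hxy)
      exact extClosed_filt _ (X := Θ j) (Z := ModuleCat.of R (X ⧸ LinearMap.range (r ∘ₗ h))) _ _
        (isSES_range hinj') (filtSet_of_mem Θ rfl) hX

lemma InAdd.prod {M X Y : ModuleCat.{u} R} (hX : InAdd M X) (hY : InAdd M Y) :
    InAdd M (ModuleCat.of R (X × Y)) := by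
  obtain ⟨m, s, r, hr⟩ := hX
  obtain ⟨m', s', r', hr'⟩ := hY
  let e := (LinearEquiv.funCongrLeft R M (finSumFinEquiv (m := m) (n := m'))).trans
    (LinearEquiv.sumArrowLequivProdArrow (Fin m) (Fin m') R M)
  refine ⟨m + m', e.symm.toLinearMap ∘ₗ s.prodMap s', r.prodMap r' ∘ₗ e.toLinearMap, ?_⟩
  refine LinearMap.ext fun x ↦ ?_
  change (r.prodMap r') (e (e.symm ((s.prodMap s') x))) = x
  rw [e.apply_symm_apply]
  exact Prod.ext (apply_of_comp_eq_id hr _) (apply_of_comp_eq_id hr' _)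

/-- All extensions in the filtration split. For a stone this gives F(Θ(i)) = add Θ(i), which is
closed under summands by definition. -/
lemma FiltSet.inAdd_of_extVanish {s : Set (Fin t)}
    (h : ∀ i ∈ s, ∀ j ∈ s, ExtVanish R (Θ i) (Θ j))
    {X : ModuleCat.{u} R} (hX : FiltSet Θ s X) : InAdd (dsum Θ s) X := by
  induction hX with
  | of_inAdd h => exact h
  | @ext X Y Z f g w hex hX hZ ih =>
    have hfg := isSES_of_shortExact hex
    have : ExtVanish R Z X := hZ.extVanish_left fun i hi ↦
      FiltSet.extVanish_right hX fun j hj ↦ h i hi j hj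
    obtain ⟨r, hr⟩ := this.exists_retraction hfg
    obtain ⟨e⟩ := hfg.equiv_prod_of_retraction hr
    exact (retractClosed_inAdd _).of_equiv e.symm (ih.prod hZ)

variable (Θ) in
/-- A family of finitely generated modules, each a brick or without self-extensions, such that
there are neither maps nor extensions from later to earlier members. -/
structure ExtDirected : Prop where
  finite : ∀ i, Module.Finite R (Θ i)
  hom : ∀ i j, j < i → ∀ f : Θ i →ₗ[R] Θ j, f = 0
  ext : ∀ i j, j < i → ExtVanish R (Θ i) (Θ j)
  brick_or : ∀ i, IsBrick (Θ i) ∨ ExtVanish R (Θ i) (Θ i)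

lemma ExtDirected.retractClosed_singleton [IsArtinianRing R] (h : ExtDirected Θ) (i : Fin t) :
    RetractClosed (FiltSet Θ {i}) := by
  rcases h.brick_or i with hi | hi
  · exact retractClosed_of_brick (h.finite i) hi
  · intro X Y hXY hY
    refine .of_inAdd (retractClosed_inAdd _ hXY (FiltSet.inAdd_of_extVanish ?_ hY))
    rintro _ rfl _ rfl
    exact hi

/-- The class `F(Θ(s))` is closed under direct summands. -/
lemma ExtDirected.retractClosed [IsArtinianRing R] (h : ExtDirected Θ) (s : Set (Fin t)) :
    RetractClosed (FiltSet Θ s) := by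
  classical
  obtain ⟨s, rfl⟩ := s.toFinite.exists_finset_coe
  induction s using Finset.induction_on_max with
  | empty =>
    rintro X Y ⟨s, r, hr⟩ hY
    have : Subsingleton X := by
      by_contra hX
      rw [not_subsingleton_iff_nontrivial] at hX
      have := (Function.LeftInverse.injective (apply_of_comp_eq_id hr)).nontrivial
      obtain ⟨j, hj, -⟩ := hY.exists_ne_zero
      simp at hj
    exact .of_subsingleton _
  -- The new index a exceeds all of s, so Θ(a) has neither maps nor extensions to Θ(s) and can be
  -- placed at the bottom.
  | insert a s hs ih =>
    rw [Finset.coe_insert, Set.insert_eq]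
    refine retractClosed_filtSet_union ?_ ?_ ?_ (h.retractClosed_singleton a) ih
    · rw [Set.disjoint_singleton_left]
      exact fun ha ↦ (hs a ha).false
    · rintro _ rfl j hj
      exact h.hom _ _ (hs j hj)
    · rintro _ rfl j hj
      exact h.ext _ _ (hs j hj)

lemma ExtDirected.filtSet_union [IsArtinianRing R] (h : ExtDirected Θ) {a b : Set (Fin t)}
    (hab : ∀ i ∈ a, ∀ j ∈ b, j < i) {X : ModuleCat.{u} R} (hX : FiltSet Θ (a ∪ b) X) :
    Star (FiltSet Θ a) (FiltSet Θ b) X := by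
  rwa [MixedStrat.filtSet_union _ (fun i hi j hj ↦ h.hom i j (hab i hi j hj))
    (fun i hi j hj ↦ h.ext i j (hab i hi j hj)) (h.retractClosed a) (h.retractClosed b)] at hX
  exact Set.disjoint_left.mpr fun i hi hi' ↦ (hab i hi i hi').false

end SummandClosure

/-! ### Local modules and indecomposability. -/

section LocalModule

variable {R : Type u} [Ring R] {X Y : Type u} [AddCommGroup X] [Module R X] [AddCommGroup Y]
  [Module R Y]

/-- A nonzero module that is not the sum of two proper submodules. -/
def IsLocalModule (R : Type u) [Ring R] (X : Type u) [AddCommGroup X] [Module R X] : Prop :=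
  Nontrivial X ∧ ∀ N N' : Submodule R X, N ⊔ N' = ⊤ → N = ⊤ ∨ N' = ⊤

lemma IsLocalModule.of_surjective (h : IsLocalModule R X) [Nontrivial Y] {f : X →ₗ[R] Y}
    (hf : Function.Surjective f) : IsLocalModule R Y := by
  refine ⟨inferInstance, fun N N' hN ↦ ?_⟩
  have key : N.comap f ⊔ N'.comap f = ⊤ := by
    rw [Submodule.eq_top_iff']
    intro x
    obtain ⟨a, ha, b, hb, hab⟩ := Submodule.mem_sup.mp (hN ▸ Submodule.mem_top (x := f x))
    obtain ⟨a, rfl⟩ := hf a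
    refine Submodule.mem_sup.mpr ⟨a, ha, x - a, ?_, by abel⟩
    change f (x - a) ∈ N'
    rwa [map_sub, ← hab, add_sub_cancel_left]
  refine (h.2 _ _ key).imp ?_ ?_ <;>
  · intro h
    rw [Submodule.eq_top_iff'] at h ⊢
    intro y
    obtain ⟨x, rfl⟩ := hf y
    exact h x

/-- Equality of the images gives im c + ker f = X, and ker f is proper. It serves to make images
shrink strictly when a map is precomposed with a non-surjective one. -/
lemma IsLocalModule.surjective_of_comp (h : IsLocalModule R X) {Z : Type u} [AddCommGroup Z]
    [Module R Z] {c : Z →ₗ[R] X} {f : X →ₗ[R] Y} (hf : f ≠ 0)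
    (hfc : LinearMap.range (f ∘ₗ c) = LinearMap.range f) : Function.Surjective c := by
  have : LinearMap.range c ⊔ LinearMap.ker f = ⊤ := by
    rw [Submodule.eq_top_iff']
    intro x
    obtain ⟨z, hz⟩ : f x ∈ LinearMap.range (f ∘ₗ c) := hfc ▸ ⟨x, rfl⟩
    have hz' : f (c z) = f x := hz
    exact Submodule.mem_sup.mpr ⟨c z, ⟨z, rfl⟩, x - c z, by simp [hz'], by abel⟩
  rcases h.2 _ _ this with h | h
  · exact LinearMap.range_eq_top.mp h
  · exact absurd (LinearMap.ker_eq_top.mp h) hf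

lemma IsLocalModule.idempotent (h : IsLocalModule R X) {f : X →ₗ[R] X} (hf : f ∘ₗ f = f) :
    f = 0 ∨ f = LinearMap.id := by
  have hf' : ∀ x, f (f x) = f x := LinearMap.congr_fun hf
  have : LinearMap.ker f ⊔ LinearMap.range f = ⊤ := by
    rw [Submodule.eq_top_iff']
    intro x
    exact Submodule.mem_sup.mpr ⟨x - f x, by simp [hf'], f x, ⟨x, rfl⟩, by abel⟩
  refine (h.2 _ _ this).imp LinearMap.ker_eq_top.mp fun h ↦ ?_
  ext x
  obtain ⟨y, rfl⟩ := LinearMap.range_eq_top.mp h x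
  exact hf' y

/-- Translates the categorical biproduct in `Indecomposable` into inclusions and projections given
as linear maps. -/
lemma indecomposable_of_idempotent {X : ModuleCat.{u} R} [Nontrivial X]
    (h : ∀ (Y Z : ModuleCat.{u} R) (s : Y →ₗ[R] X) (r : X →ₗ[R] Y) (s' : Z →ₗ[R] X)
      (r' : X →ₗ[R] Z), r ∘ₗ s = LinearMap.id → r' ∘ₗ s' = LinearMap.id → r' ∘ₗ s = 0 →
      r ∘ₗ s' = 0 → s ∘ₗ r + s' ∘ₗ r' = LinearMap.id → Subsingleton Y ∨ Subsingleton Z) :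
    Indecomposable X := by
  refine ⟨fun h0 ↦ not_subsingleton X (ModuleCat.subsingleton_of_isZero h0), fun Y Z e ↦ ?_⟩
  have e1 : ∀ {A B : ModuleCat.{u} R} {f g : A ⟶ B}, f = g → f.hom = g.hom := fun h ↦ h ▸ rfl
  refine (h Y Z (Limits.biprod.inl ≫ e.inv).hom (e.hom ≫ Limits.biprod.fst).hom
    (Limits.biprod.inr ≫ e.inv).hom (e.hom ≫ Limits.biprod.snd).hom
    (e1 (f := (Limits.biprod.inl ≫ e.inv) ≫ e.hom ≫ Limits.biprod.fst) (g := 𝟙 Y) (by simp))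
    (e1 (f := (Limits.biprod.inr ≫ e.inv) ≫ e.hom ≫ Limits.biprod.snd) (g := 𝟙 Z) (by simp))
    (e1 (f := (Limits.biprod.inl ≫ e.inv) ≫ e.hom ≫ Limits.biprod.snd) (g := 0) (by simp))
    (e1 (f := (Limits.biprod.inr ≫ e.inv) ≫ e.hom ≫ Limits.biprod.fst) (g := 0) (by simp))
    (e1 (f := (e.hom ≫ Limits.biprod.fst) ≫ (Limits.biprod.inl ≫ e.inv) +
      (e.hom ≫ Limits.biprod.snd) ≫ (Limits.biprod.inr ≫ e.inv)) (g := 𝟙 X) ?_)).imp ?_ ?_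
  · have : e.hom ≫ (Limits.biprod.fst ≫ Limits.biprod.inl +
        Limits.biprod.snd ≫ Limits.biprod.inr) ≫ e.inv = 𝟙 X := by
      rw [Limits.biprod.total]; simp
    simp only [Category.assoc, Preadditive.add_comp, Preadditive.comp_add] at this ⊢
    exact this
  · intro h
    exact ModuleCat.isZero_of_subsingleton _
  · intro h
    exact ModuleCat.isZero_of_subsingleton _

lemma IsLocalModule.indecomposable {X : ModuleCat.{u} R} (h : IsLocalModule R X) :
    Indecomposable X := by
  have := h.1
  refine indecomposable_of_idempotent fun Y Z s r s' r' hr hr' h1 h2 hsum ↦ ?_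
  have hr := apply_of_comp_eq_id hr
  have hr' := apply_of_comp_eq_id hr'
  rcases h.idempotent (f := s ∘ₗ r) (by ext x; simp [hr]) with h0 | h0
  · left
    exact ⟨fun a b ↦ by
      rw [← hr a, ← hr b, ← hr (r (s a)), ← hr (r (s b))]
      have := LinearMap.congr_fun h0
      simp only [LinearMap.comp_apply, LinearMap.zero_apply] at this
      rw [this, this]⟩
  · right
    have key : ∀ z, s' z = 0 := fun z ↦ by
      have := LinearMap.congr_fun h0 (s' z)
      rw [LinearMap.comp_apply, show r (s' z) = 0 from LinearMap.congr_fun h2 z, map_zero] at this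
      exact this.symm
    exact ⟨fun a b ↦ by rw [← hr' a, ← hr' b, key, key]⟩

end LocalModule

/-! ### Dimension bounds for Hom spaces over the ground field. -/

section Dimension

variable {k : Type*} [Field k] {R : Type u} [Ring R] [Algebra k R]

/-- An `R`-module comes without a chosen `k`-structure; the one pulled back along k → R is installed
locally wherever dimensions are counted. -/
lemma isScalarTower_compHom (X : Type u) [AddCommGroup X] [Module R X] :
    letI := Module.compHom X (algebraMap k R)
    IsScalarTower k R X := by
  let _ := Module.compHom X (algebraMap k R)
  refine ⟨fun a r x ↦ ?_⟩
  rw [Algebra.smul_def, mul_smul]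
  rfl

lemma finite_linearMap [FiniteDimensional k R] (X Y : Type u) [AddCommGroup X] [Module R X]
    [AddCommGroup Y] [Module R Y] [Module k X] [IsScalarTower k R X] [Module k Y]
    [IsScalarTower k R Y] [Module.Finite R X] [Module.Finite R Y] :
    Module.Finite k (X →ₗ[R] Y) := by
  have : Module.Finite k X := .trans R X
  have : Module.Finite k Y := .trans R Y
  refine Module.Finite.of_injective (LinearMap.restrictScalarsₗ k R X Y k) ?_
  exact LinearMap.restrictScalars_injective k

variable (k) in
/-- The `k`-dimension of `Hom_R(X, Y)`. -/
noncomputable def homDim (R : Type u) [Ring R] [Algebra k R] (X Y : Type u) [AddCommGroup X]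
    [Module R X] [AddCommGroup Y] [Module R Y] : ℕ :=
  letI := Module.compHom X (algebraMap k R)
  letI := Module.compHom Y (algebraMap k R)
  haveI := isScalarTower_compHom (k := k) (R := R) Y
  Module.finrank k (X →ₗ[R] Y)

variable [FiniteDimensional k R]
variable {P K M M' N : Type u} [AddCommGroup P] [Module R P] [AddCommGroup K] [Module R K]
  [AddCommGroup M] [Module R M] [AddCommGroup M'] [Module R M'] [AddCommGroup N] [Module R N]

/-- Composition with f embeds Hom(P, M) into Hom(P, M') and misses g. -/
lemma homDim_lt [Module.Finite R P] [Module.Finite R M'] {f : M →ₗ[R] M'} (hf : Function.Injective f) {g : P →ₗ[R] M'}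
    (hg : ∀ h : P →ₗ[R] M, f ∘ₗ h ≠ g) : homDim k R P M < homDim k R P M' := by
  let _ := Module.compHom P (algebraMap k R)
  let _ := Module.compHom M (algebraMap k R)
  let _ := Module.compHom M' (algebraMap k R)
  have := isScalarTower_compHom (k := k) (R := R) P
  have := isScalarTower_compHom (k := k) (R := R) M
  have := isScalarTower_compHom (k := k) (R := R) M'
  have := finite_linearMap (k := k) (R := R) P M'
  let F : (P →ₗ[R] M) →ₗ[k] (P →ₗ[R] M') :=
    { toFun := fun h ↦ f ∘ₗ h
      map_add' := fun a b ↦ by ext; simp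
      map_smul' := fun c a ↦ by ext x; exact LinearMap.map_smul_of_tower f c (a x) }
  have hF : Function.Injective F := fun a b hab ↦ by
    ext x
    exact hf (LinearMap.congr_fun hab x)
  have h1 : Module.finrank k (LinearMap.range F) < Module.finrank k (P →ₗ[R] M') := by
    refine Submodule.finrank_lt fun h ↦ ?_
    obtain ⟨h, hh⟩ := LinearMap.range_eq_top.mp h g
    exact hg h hh
  rwa [LinearMap.finrank_range_of_inj hF] at h1

/-- Let `0 → M → M' → N → 0` be exact and `K ⊆ P` with `P` projective. Suppose that every map
`P → M'` that vanishes on `K` takes values in `M`, and that every nonzero map `P → N` has a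
nonzero composition with some endomorphism of `P` that vanishes on `K`. Then the dimension of
`Hom(P, N)` is bounded in terms of `P`, `K` and `M`. -/
lemma homDim_le_of_essential [Module.Finite R P] [Module.Finite R K] [Module.Finite R M]
    [Module.Finite R M'] [Module.Finite R N] [Module.Projective R P] {i : K →ₗ[R] P} {ι : M →ₗ[R] M'}
    {π : M' →ₗ[R] N} (h : IsSES ι π)
    (hland : ∀ f : P →ₗ[R] M', f ∘ₗ i = 0 → π ∘ₗ f = 0)
    (hsoc : ∀ f : P →ₗ[R] N, f ≠ 0 → ∃ a : P →ₗ[R] P, f ∘ₗ a ≠ 0 ∧ f ∘ₗ a ∘ₗ i = 0) :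
    homDim k R P N ≤ homDim k R P P * homDim k R K M := by
  let _ := Module.compHom P (algebraMap k R)
  let _ := Module.compHom M (algebraMap k R)
  let _ := Module.compHom M' (algebraMap k R)
  let _ := Module.compHom N (algebraMap k R)
  let _ := Module.compHom K (algebraMap k R)
  have := isScalarTower_compHom (k := k) (R := R) P
  have := isScalarTower_compHom (k := k) (R := R) M
  have := isScalarTower_compHom (k := k) (R := R) M'
  have := isScalarTower_compHom (k := k) (R := R) N
  have := isScalarTower_compHom (k := k) (R := R) K
  have := finite_linearMap (k := k) (R := R) P P
  have := finite_linearMap (k := k) (R := R) P N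
  have := finite_linearMap (k := k) (R := R) P M'
  have := finite_linearMap (k := k) (R := R) K M
  let W : Submodule k (P →ₗ[R] N) :=
    { carrier := {g | g ∘ₗ i = 0}
      add_mem' := fun {a b} ha hb ↦ by
        have ha' : a ∘ₗ i = 0 := ha
        have hb' : b ∘ₗ i = 0 := hb
        change (a + b) ∘ₗ i = 0
        rw [LinearMap.add_comp, ha', hb', add_zero]
      zero_mem' := LinearMap.zero_comp i
      smul_mem' := fun c a ha ↦ by
        have ha' : a ∘ₗ i = 0 := ha
        change (c • a) ∘ₗ i = 0
        rw [LinearMap.smul_comp, ha', smul_zero] }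
  let πs : (P →ₗ[R] M') →ₗ[k] (P →ₗ[R] N) :=
    { toFun := fun h ↦ π ∘ₗ h
      map_add' := fun a b ↦ by ext; simp
      map_smul' := fun c a ↦ by ext x; exact LinearMap.map_smul_of_tower π c (a x) }
  have hπs : LinearMap.range πs = ⊤ := LinearMap.range_eq_top.mpr fun g ↦
    Module.projective_lifting_property π g h.surj
  let ιs : (K →ₗ[R] M) →ₗ[k] (K →ₗ[R] M') :=
    { toFun := fun h ↦ ι ∘ₗ h
      map_add' := fun a b ↦ by ext; simp
      map_smul' := fun c a ↦ by ext x; exact LinearMap.map_smul_of_tower ι c (a x) }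
  have hιs : LinearMap.ker ιs = ⊥ := LinearMap.ker_eq_bot.mpr fun a b hab ↦ by
    ext x
    exact h.inj (LinearMap.congr_fun hab x)
  obtain ⟨σ, hσ⟩ := πs.exists_rightInverse_of_surjective hπs
  obtain ⟨lam, hlam⟩ := ιs.exists_leftInverse_of_injective hιs
  obtain ⟨μ, hμ⟩ := W.subtype.exists_leftInverse_of_injective (Submodule.ker_subtype W)
  have hσ' : ∀ g, π ∘ₗ σ g = g := LinearMap.congr_fun hσ
  let res : (P →ₗ[R] M') →ₗ[k] (K →ₗ[R] M') :=
    { toFun := fun h ↦ h ∘ₗ i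
      map_add' := fun a b ↦ by ext; simp
      map_smul' := fun c a ↦ by ext x; rfl }
  -- A map g in W is lifted to P → M' and restricted to K, where it takes values in M. If the
  -- restriction is zero, the lift vanishes on K, hence takes values in M by `hland`, and g = 0.
  have hW : Module.finrank k W ≤ Module.finrank k (K →ₗ[R] M) := by
    refine LinearMap.finrank_le_finrank_of_injective (f := lam ∘ₗ res ∘ₗ σ ∘ₗ W.subtype) ?_
    rw [injective_iff_map_eq_zero]
    rintro ⟨g, hg⟩ hg0
    have hg : g ∘ₗ i = 0 := hg
    obtain ⟨v, hv⟩ := h.exists_lift (σ g ∘ₗ i) (by rw [← LinearMap.comp_assoc, hσ', hg])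
    have hv0 : v = 0 := by
      rw [← LinearMap.id_apply (R := k) v, ← hlam]
      change lam (ι ∘ₗ v) = 0
      rw [hv]
      exact hg0
    have := hland (σ g) (by rw [← hv, hv0, LinearMap.comp_zero])
    rw [hσ'] at this
    exact Subtype.ext this
  -- The linear projection μ onto W makes a ↦ f ∘ a land in W for every f. By `hsoc` some f ∘ a is
  -- nonzero and already in W, so F is injective.
  let F : (P →ₗ[R] N) →ₗ[k] (P →ₗ[R] P) →ₗ[k] W :=
    LinearMap.mk₂ k (fun f a ↦ μ (f ∘ₗ a)) (fun f g a ↦ by rw [LinearMap.add_comp, map_add])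
      (fun c f a ↦ by rw [LinearMap.smul_comp, map_smul])
      (fun f a b ↦ by rw [LinearMap.comp_add, map_add])
      (fun c f a ↦ by
        rw [← map_smul]
        congr 1
        ext x
        exact LinearMap.map_smul_of_tower f c (a x))
  have hF : Function.Injective F := by
    rw [injective_iff_map_eq_zero]
    intro f hf
    by_contra hf0
    obtain ⟨a, ha, ha'⟩ := hsoc f hf0
    have h1 : μ (f ∘ₗ a) = 0 := LinearMap.congr_fun hf a
    have h2 : μ (f ∘ₗ a) = ⟨f ∘ₗ a, ha'⟩ := LinearMap.congr_fun hμ ⟨f ∘ₗ a, ha'⟩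
    exact ha (congrArg Subtype.val (h2.symm.trans h1))
  calc homDim k R P N ≤ Module.finrank k ((P →ₗ[R] P) →ₗ[k] W) :=
        LinearMap.finrank_le_finrank_of_injective hF
    _ = Module.finrank k (P →ₗ[R] P) * Module.finrank k W := Module.finrank_linearMap k k _ _
    _ ≤ _ := Nat.mul_le_mul_left _ hW

end Dimension

/-- The space `Hom(K, M)` is spanned by finitely many maps, for every notion of subspace that is
induced by a map out of `M` and a map out of `K`. -/
lemma exists_finset_forall_extend (k : Type*) [Field k] {R : Type u} [Ring R] [Algebra k R]
    [FiniteDimensional k R] (K M : Type u) [AddCommGroup K] [Module R K]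
    [AddCommGroup M] [Module R M] [Module.Finite R K] [Module.Finite R M] :
    ∃ S : Finset (K →ₗ[R] M), ∀ {P M' : Type u} [AddCommGroup P] [Module R P] [AddCommGroup M']
      [Module R M'] (i : K →ₗ[R] P) (ι : M →ₗ[R] M'),
      (∀ f ∈ S, ∃ F : P →ₗ[R] M', F ∘ₗ i = ι ∘ₗ f) → ∀ f, ∃ F : P →ₗ[R] M', F ∘ₗ i = ι ∘ₗ f := by
  let _ := Module.compHom M (algebraMap k R)
  let _ := Module.compHom K (algebraMap k R)
  have := isScalarTower_compHom (k := k) (R := R) M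
  have := isScalarTower_compHom (k := k) (R := R) K
  have := finite_linearMap (k := k) (R := R) K M
  -- The maps f for which ι ∘ f extends along i form a `k`-subspace, so a spanning set suffices. It
  -- is fixed before ι, so M may be enlarged afterwards.
  obtain ⟨S, hS⟩ := Module.Finite.fg_top (R := k) (M := K →ₗ[R] M)
  refine ⟨S, fun {P M'} _ _ _ _ i ι H f ↦ ?_⟩
  let _ := Module.compHom M' (algebraMap k R)
  have := isScalarTower_compHom (k := k) (R := R) M'
  have hf : f ∈ Submodule.span k (S : Set (K →ₗ[R] M)) := hS ▸ Submodule.mem_top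
  induction hf using Submodule.span_induction with
  | mem f hf => exact H f hf
  | zero => exact ⟨0, by simp⟩
  | add f g _ _ hf hg =>
    obtain ⟨F, hF⟩ := hf
    obtain ⟨G, hG⟩ := hg
    exact ⟨F + G, by rw [LinearMap.add_comp, hF, hG, LinearMap.comp_add]⟩
  | smul c f _ hf =>
    obtain ⟨F, hF⟩ := hf
    refine ⟨c • F, ?_⟩
    rw [LinearMap.smul_comp, hF]
    ext x
    exact (LinearMap.map_smul_of_tower ι c (f x)).symm

/-! ### Construction of the modules T(i) by successive extensions. -/

section CoverData

variable {R : Type u} [Ring R] {t : ℕ}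

/-- Projective covers `p i : P i → Θ i` of the members of an `ExtDirected` family, by local
projective modules, such that the kernel of `p i` is filtered by `Θ(≥ i)`. -/
structure CoverData (Θ P : Fin t → ModuleCat.{u} R) (p : ∀ i, P i →ₗ[R] Θ i) : Prop
    extends ExtDirected Θ where
  finite_proj : ∀ i, Module.Finite R (P i)
  projective : ∀ i, Module.Projective R (P i)
  local_proj : ∀ i, IsLocalModule R (P i)
  surj : ∀ i, Function.Surjective (p i)
  nontrivial : ∀ i, Nontrivial (Θ i)
  ker_mem : ∀ i, FiltSet Θ (Set.Ici i) (ModuleCat.of R (LinearMap.ker (p i)))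
  hom_proj : ∀ i j, j < i → ∀ f : P i →ₗ[R] Θ j, f = 0

variable {Θ P : Fin t → ModuleCat.{u} R} {p : ∀ i, P i →ₗ[R] Θ i}

/-- A nonzero map from a module filtered by `Θ(≥ i)` to a module that receives no maps from
`P(> i)` is nonzero on the image of some map from `P i`. -/
lemma FiltSet.exists_proj_comp_ne_zero (hproj : ∀ i, Module.Projective R (P i))
    (hsurj : ∀ i, Function.Surjective (p i)) {i : Fin t} {X W : ModuleCat.{u} R}
    (hX : FiltSet Θ (Set.Ici i) X) (hW : ∀ j, i < j → ∀ f : P j →ₗ[R] W, f = 0)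
    {h : X →ₗ[R] W} (hh : h ≠ 0) : ∃ c : P i →ₗ[R] X, h ∘ₗ c ≠ 0 := by
  have key : ∀ {Y : ModuleCat.{u} R}, InAdd (dsum Θ (Set.Ici i)) Y → ∀ g : Y →ₗ[R] W, g ≠ 0 →
      ∃ c : P i →ₗ[R] Y, g ∘ₗ c ≠ 0 := by
    intro Y hY g hg
    obtain ⟨j, hj, β, hβ⟩ := hY.exists_comp_ne_zero g hg
    have hne : (g ∘ₗ β) ∘ₗ p j ≠ 0 := fun h0 ↦ hβ <| by
      ext x
      obtain ⟨y, rfl⟩ := hsurj j x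
      exact LinearMap.congr_fun h0 y
    obtain rfl | hij := (show i ≤ j from hj).eq_or_lt
    · exact ⟨β ∘ₗ p i, hne⟩
    · exact absurd (hW j hij _) hne
  induction hX with
  | of_inAdd hX => exact key hX h hh
  | @ext X Y Z a b w hex hX hZ ih =>
    have hab := isSES_of_shortExact hex
    by_cases ha : h ∘ₗ a.hom = 0
    · obtain ⟨h', rfl⟩ := hab.exists_desc h ha
      obtain ⟨c, hc⟩ := key hZ h' (by rintro rfl; exact hh rfl)
      have := hproj i
      obtain ⟨c', rfl⟩ := Module.projective_lifting_property b.hom c hab.surj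
      exact ⟨c', hc⟩
    · obtain ⟨c, hc⟩ := ih ha
      exact ⟨a.hom ∘ₗ c, hc⟩

lemma CoverData.ker_ne_top (h : CoverData Θ P p) (i : Fin t) : LinearMap.ker (p i) ≠ ⊤ := by
  intro h0
  obtain ⟨x, hx⟩ := @exists_ne _ (h.nontrivial i) (0 : Θ i)
  obtain ⟨y, rfl⟩ := h.surj i x
  exact hx (LinearMap.mem_ker.mp (h0 ▸ Submodule.mem_top))

/-- Every nonzero map `P i → X`, with `X` filtered by `Θ i`, can be precomposed with an
endomorphism of `P i` so that it becomes a nonzero map that factors through `Θ i`. -/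
lemma CoverData.exists_endomorphism [IsArtinianRing R] (h : CoverData Θ P p) {i : Fin t}
    {X : ModuleCat.{u} R} (hX : FiltSet Θ {i} X) {f : P i →ₗ[R] X} (hf : f ≠ 0) :
    ∃ a : P i →ₗ[R] P i, f ∘ₗ a ≠ 0 ∧ f ∘ₗ a ∘ₗ (LinearMap.ker (p i)).subtype = 0 := by
  have : Module.Finite R X := hX.finite fun j _ ↦ h.finite j
  induction hN : LinearMap.range f using WellFoundedLT.induction generalizing f with
  | _ N ih =>
    by_cases hfK : f ∘ₗ (LinearMap.ker (p i)).subtype = 0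
    · exact ⟨LinearMap.id, hf, hfK⟩
    · have hW : ∀ j, i < j → ∀ f : P j →ₗ[R] X, f = 0 := fun j hij ↦ hX.hom_eq_zero' <| by
        rintro _ rfl
        exact h.hom_proj _ _ hij
      obtain ⟨c, hc⟩ := (h.ker_mem i).exists_proj_comp_ne_zero h.projective h.surj hW hfK
      have hc : f ∘ₗ ((LinearMap.ker (p i)).subtype ∘ₗ c) ≠ 0 := hc
      obtain ⟨a, ha, ha'⟩ := ih (LinearMap.range (f ∘ₗ ((LinearMap.ker (p i)).subtype ∘ₗ c)))
        (by
          rw [← hN]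
          -- The image shrinks strictly: otherwise the map P(i) → ker (p i) → P(i) would be onto,
          -- but ker (p i) is proper.
          refine lt_of_le_of_ne (LinearMap.range_comp_le_range _ _) fun heq ↦ ?_
          have hs := (h.local_proj i).surjective_of_comp hf heq
          refine h.ker_ne_top i (eq_top_iff.mpr fun x _ ↦ ?_)
          obtain ⟨y, rfl⟩ := hs x
          exact (c y).2) hc rfl
      exact ⟨((LinearMap.ker (p i)).subtype ∘ₗ c) ∘ₗ a, ha, ha'⟩

/-- The quotient of an iterated extension is an extension. -/
lemma IsSES.comp {A B C E Q : Type u} [AddCommGroup A] [Module R A] [AddCommGroup B] [Module R B]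
    [AddCommGroup C] [Module R C] [AddCommGroup E] [Module R E] [AddCommGroup Q] [Module R Q]
    {ι : A →ₗ[R] B} {π : B →ₗ[R] C} {j : B →ₗ[R] E} {q : E →ₗ[R] Q} (h : IsSES ι π)
    (h' : IsSES j q) : ∃ (C' : ModuleCat.{u} R) (π' : E →ₗ[R] C') (a : C →ₗ[R] C')
      (b : C' →ₗ[R] Q), IsSES (j ∘ₗ ι) π' ∧ IsSES a b ∧ a ∘ₗ π = π' ∘ₗ j ∧ b ∘ₗ π' = q := by
  let N := LinearMap.range (j ∘ₗ ι)
  have hN : IsSES (j ∘ₗ ι) N.mkQ := isSES_range (h'.inj.comp h.inj)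
  obtain ⟨a, ha⟩ := h.exists_desc (N.mkQ ∘ₗ j) hN.comp_eq_zero
  obtain ⟨b, hb⟩ := hN.exists_desc q
    (by rw [← LinearMap.comp_assoc, h'.comp_eq_zero, LinearMap.zero_comp])
  have ha' : ∀ x, a (π x) = N.mkQ (j x) := LinearMap.congr_fun ha
  have hb' : ∀ x, b (N.mkQ x) = q x := LinearMap.congr_fun hb
  refine ⟨ModuleCat.of R (E ⧸ N), N.mkQ, a, b, hN, ⟨?_, ?_, ?_⟩, ha, hb⟩
  · rw [injective_iff_map_eq_zero]
    intro c hc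
    obtain ⟨x, rfl⟩ := h.surj c
    rw [ha'] at hc
    obtain ⟨y, hy⟩ := (hN.exact _).mp hc
    rw [← h'.inj hy, h.apply_apply]
  · intro z
    obtain ⟨y, rfl⟩ := h'.surj z
    exact ⟨N.mkQ y, hb' y⟩
  · intro c
    constructor
    · intro hc
      obtain ⟨x, rfl⟩ := N.mkQ_surjective c
      rw [hb'] at hc
      obtain ⟨y, rfl⟩ := (h'.exact _).mp hc
      exact ⟨π y, ha' y⟩
    · rintro ⟨c, rfl⟩
      obtain ⟨x, rfl⟩ := h.surj c
      rw [ha', hb', h'.apply_apply]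

/-- If `Θ i` is a brick, then every finitely generated module `M` has an extension `M'` by a module
filtered by `Θ i` such that `Ext¹(Θ i, M') = 0` and every map `Θ i → M'` takes values in `M`. -/
lemma CoverData.exists_extension_of_brick [IsArtinianRing R] (k : Type*) [Field k] [Algebra k R]
    [FiniteDimensional k R] (h : CoverData Θ P p) {i : Fin t}
    (hi : IsBrick (Θ i)) (M : ModuleCat.{u} R) [Module.Finite R M] :
    ∃ (M' N : ModuleCat.{u} R) (ι : M →ₗ[R] M') (π : M' →ₗ[R] N), IsSES ι π ∧
      FiltSet Θ {i} N ∧ ExtVanish R (Θ i) M' ∧ ∀ f : Θ i →ₗ[R] M', π ∘ₗ f = 0 := by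
  have := h.finite_proj i
  have := h.projective i
  have hip := isSES_ker (h.surj i)
  have hfinN : ∀ {N : ModuleCat.{u} R}, FiltSet Θ {i} N → Module.Finite R N :=
    fun hN ↦ FiltSet.finite hN fun j _ ↦ h.finite j
  -- A bound on dim Hom(P(i), N) depending on M alone. Each nonsplit extension raises this
  -- dimension, so D minus the dimension decreases; the start is M' = M, N = 0.
  let D := homDim k R (P i) (P i) * homDim k R (LinearMap.ker (p i)) M
  suffices H : ∀ (d : ℕ) (M' N : ModuleCat.{u} R) (ι : M →ₗ[R] M') (π : M' →ₗ[R] N), IsSES ι π →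
      FiltSet Θ {i} N → (∀ f : Θ i →ₗ[R] M', π ∘ₗ f = 0) → D - homDim k R (P i) N = d →
      ∃ (M' N : ModuleCat.{u} R) (ι : M →ₗ[R] M') (π : M' →ₗ[R] N), IsSES ι π ∧
        FiltSet Θ {i} N ∧ ExtVanish R (Θ i) M' ∧ ∀ f : Θ i →ₗ[R] M', π ∘ₗ f = 0 from
    H _ M (ModuleCat.of R PUnit) LinearMap.id 0
      ⟨fun _ _ ↦ id, fun _ ↦ ⟨0, rfl⟩, fun y ↦ ⟨fun _ ↦ ⟨y, rfl⟩, fun _ ↦ rfl⟩⟩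
      (.of_subsingleton _) (fun _ ↦ LinearMap.zero_comp _) rfl
  intro d
  induction d using Nat.strong_induction_on with
  | _ d ih =>
    intro M' N ι π hιπ hN hland hd
    by_cases hext : ExtVanish R (Θ i) M'
    · exact ⟨M', N, ι, π, hιπ, hN, hext, hland⟩
    obtain ⟨E, j, q, hjq, hns⟩ := exists_nonsplit_of_not_extVanish hip hext
    obtain ⟨N', π', a, b, hιπ', hab, haπ, hbπ⟩ := hιπ.comp hjq
    have hN' : FiltSet Θ {i} N' := .of_isSES_inAdd hab hN (inAdd_dsum_of_mem Θ rfl)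
    have hland' : ∀ f : Θ i →ₗ[R] E, π' ∘ₗ f = 0 := by
      intro f
      by_cases hqf : q ∘ₗ f = 0
      · obtain ⟨f', rfl⟩ := hjq.exists_lift f hqf
        rw [← LinearMap.comp_assoc, ← haπ, LinearMap.comp_assoc, hland, LinearMap.comp_zero]
      -- In a brick the nonzero endomorphism q ∘ f is invertible, which would split the extension E.
      · obtain ⟨g, -, hg⟩ := hi.exists_inverse hqf
        exact absurd hg (hns (f ∘ₗ g))
    have := hfinN hN
    have := hfinN hN'
    have := hιπ'.finite
    have hle : homDim k R (P i) N' ≤ D := by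
      refine homDim_le_of_essential (i := (LinearMap.ker (p i)).subtype) hιπ' ?_ ?_
      · intro f hf
        obtain ⟨f', rfl⟩ := hip.exists_desc f hf
        rw [← LinearMap.comp_assoc, hland', LinearMap.zero_comp]
      · exact fun f hf ↦ h.exists_endomorphism hN' hf
    -- A lift of p(i) to N' does not come from N, since its image in Θ(i) is nonzero.
    have hlt : homDim k R (P i) N < homDim k R (P i) N' := by
      obtain ⟨g, hg⟩ := Module.projective_lifting_property b (p i) hab.surj
      refine homDim_lt hab.inj (g := g) fun h' hh' ↦ h.ker_ne_top i ?_
      rw [LinearMap.ker_eq_top, ← hg, ← hh', ← LinearMap.comp_assoc, hab.comp_eq_zero,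
        LinearMap.zero_comp]
    exact ih (D - homDim k R (P i) N') (by omega) E N' _ π' hιπ' hN' hland' rfl

/-- Every finitely generated module `M` has an extension `M'` by a module filtered by `Θ i` such
that `Ext¹(Θ i, M') = 0`. -/
lemma CoverData.exists_extension [IsArtinianRing R] (k : Type*) [Field k] [Algebra k R]
    [FiniteDimensional k R] (h : CoverData Θ P p) (i : Fin t)
    (M : ModuleCat.{u} R) [Module.Finite R M] :
    ∃ (M' N : ModuleCat.{u} R) (ι : M →ₗ[R] M') (π : M' →ₗ[R] N), IsSES ι π ∧
      FiltSet Θ {i} N ∧ ExtVanish R (Θ i) M' := by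
  rcases h.brick_or i with hi | hi
  · obtain ⟨M', N, ι, π, h1, h2, h3, -⟩ := h.exists_extension_of_brick k hi M
    exact ⟨M', N, ι, π, h1, h2, h3⟩
  have := h.projective i
  have := h.finite_proj i
  have hip := isSES_ker (h.surj i)
  obtain ⟨S, hS⟩ := exists_finset_forall_extend k (R := R) (LinearMap.ker (p i)) M
  obtain ⟨M', N, ι, π, hιπ, hN, hext⟩ : ∃ (M' N : ModuleCat.{u} R) (ι : M →ₗ[R] M')
      (π : M' →ₗ[R] N), IsSES ι π ∧ FiltSet Θ {i} N ∧ ∀ f ∈ S, ∃ F : P i →ₗ[R] M',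
        F ∘ₗ (LinearMap.ker (p i)).subtype = ι ∘ₗ f := by
    classical
    clear hS
    induction S using Finset.induction_on with
    | empty =>
      exact ⟨M, ModuleCat.of R PUnit, LinearMap.id, 0,
        ⟨fun _ _ ↦ id, fun _ ↦ ⟨0, rfl⟩, fun y ↦ ⟨fun _ ↦ ⟨y, rfl⟩, fun _ ↦ rfl⟩⟩,
        .of_subsingleton _, by simp⟩
    | insert f S _ ih =>
      obtain ⟨M', N, ι, π, hιπ, hN, hext⟩ := ih
      obtain ⟨E, j, q, F, hjq, hF, -⟩ := hip.exists_pushout (ι ∘ₗ f)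
      obtain ⟨N', π', a, b, hιπ', hab, -, -⟩ := hιπ.comp hjq
      refine ⟨E, N', _, π', hιπ', .of_isSES_inAdd hab hN (inAdd_dsum_of_mem Θ rfl), ?_⟩
      intro g hg
      rcases Finset.mem_insert.mp hg with rfl | hg
      · exact ⟨F, hF⟩
      · obtain ⟨G, hG⟩ := hext g hg
        exact ⟨j ∘ₗ G, by rw [LinearMap.comp_assoc, hG]; rfl⟩
  refine ⟨M', N, ι, π, hιπ, hN, extVanish_of_extend hip fun g ↦ ?_⟩
  -- Given g : K → M', its image in N extends to P(i) because Θ(i) has no self-extensions. Lifting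
  -- that extension to M' and subtracting leaves a map K → M, which extends by the choice of `S`.
  have hvan : ExtVanish R (Θ i) N := hN.extVanish_right (by rintro _ rfl; exact hi)
  obtain ⟨v, hv⟩ := hvan.exists_extend hip (π ∘ₗ g)
  obtain ⟨w, rfl⟩ := Module.projective_lifting_property π v hιπ.surj
  obtain ⟨f, hf⟩ := hιπ.exists_lift (g - w ∘ₗ (LinearMap.ker (p i)).subtype)
    (by rw [LinearMap.comp_sub, ← LinearMap.comp_assoc, hv, sub_self])
  obtain ⟨F, hF⟩ := hS _ ι hext f
  exact ⟨F + w, by rw [LinearMap.add_comp, hF, hf, sub_add_cancel]⟩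

/-- An embedding of `Θ i` into `T` with cokernel filtered by `Θ(≤ i)` through which all maps
`Θ i → T` factor, where `Ext¹(Θ l, T) = 0` for all `l ≥ m`. -/
structure IsExtHull (Θ : Fin t → ModuleCat.{u} R) (i : Fin t) (m : ℕ) (T : ModuleCat.{u} R)
    (ι : Θ i →ₗ[R] T) : Prop where
  inj : Function.Injective ι
  coker : FiltSet Θ (Set.Iic i) (ModuleCat.of R (T ⧸ LinearMap.range ι))
  land : ∀ f : Θ i →ₗ[R] T, ∀ x, f x ∈ LinearMap.range ι
  ext : ∀ l : Fin t, m ≤ l → ExtVanish R (Θ l) T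

lemma IsExtHull.finite (h : ExtDirected Θ) {i : Fin t} {m : ℕ} {T : ModuleCat.{u} R}
    {ι : Θ i →ₗ[R] T} (hT : IsExtHull Θ i m T ι) : Module.Finite R T := by
  have := h.finite i
  have := hT.coker.finite fun j _ ↦ h.finite j
  exact (isSES_range hT.inj).finite

/-- For l > i the vanishing is automatic from the directedness, so only self-extensions have to be
removed. For a stone Θ(i) itself works. -/
lemma CoverData.exists_isExtHull_self [IsArtinianRing R] (k : Type*) [Field k] [Algebra k R]
    [FiniteDimensional k R] (h : CoverData Θ P p) (i : Fin t) :
    ∃ (T : ModuleCat.{u} R) (ι : Θ i →ₗ[R] T), IsExtHull Θ i i T ι := by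
  have := h.finite i
  rcases h.brick_or i with hi | hi
  · obtain ⟨T, N, ι, π, hιπ, hN, hext, hland⟩ := h.exists_extension_of_brick k hi (Θ i)
    refine ⟨T, ι, hιπ.inj, ?_, fun f x ↦ ?_, fun l hl ↦ ?_⟩
    · exact Filt.of_equiv (X := N) hιπ.quotEquiv.symm (hN.mono (by simp))
    · exact (hιπ.exact _).mp (LinearMap.congr_fun (hland f) x)
    · obtain rfl | hl := (Fin.le_def.mpr hl).eq_or_lt
      · exact hext
      · exact .of_ses_right hιπ (h.ext _ _ hl)
          (hN.extVanish_right (by rintro _ rfl; exact h.ext _ _ hl))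
  · refine ⟨Θ i, LinearMap.id, fun _ _ ↦ id, ?_, fun f x ↦ ⟨f x, rfl⟩, fun l hl ↦ ?_⟩
    · have : Subsingleton (Θ i ⧸ LinearMap.range (LinearMap.id : Θ i →ₗ[R] Θ i)) :=
        Submodule.Quotient.subsingleton_iff.mpr LinearMap.range_id
      exact .of_subsingleton _
    · obtain rfl | hl := (Fin.le_def.mpr hl).eq_or_lt
      · exact hi
      · exact h.ext _ _ hl

/-- Descending induction on the threshold m. Adding copies of Θ(m) for m < i creates no maps from
Θ(i) and keeps Ext¹(Θ(l), T) = 0 for l > m, so earlier vanishing is never lost. -/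
lemma CoverData.exists_isExtHull [IsArtinianRing R] (k : Type*) [Field k] [Algebra k R]
    [FiniteDimensional k R] (h : CoverData Θ P p) (i : Fin t) :
    ∃ (T : ModuleCat.{u} R) (ι : Θ i →ₗ[R] T), IsExtHull Θ i 0 T ι := by
  suffices H : ∀ m ≤ (i : ℕ), ∃ (T : ModuleCat.{u} R) (ι : Θ i →ₗ[R] T), IsExtHull Θ i m T ι from
    H 0 (Nat.zero_le _)
  intro m hm
  induction hm using Nat.decreasingInduction with
  | self => exact h.exists_isExtHull_self k i
  | of_succ m hm ih =>
    obtain ⟨T, ι, hT⟩ := ih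
    have := hT.finite h.toExtDirected
    let l₀ : Fin t := ⟨m, hm.trans i.2⟩
    have hl₀ : l₀ < i := Fin.lt_def.mpr hm
    obtain ⟨E, N, j, q, hjq, hN, hext⟩ := h.exists_extension k l₀ T
    obtain ⟨C', π', a, b, hπ', hab, -, -⟩ := (isSES_range hT.inj).comp hjq
    refine ⟨E, j ∘ₗ ι, hπ'.inj, ?_, fun f x ↦ ?_, fun l hl ↦ ?_⟩
    · refine Filt.of_equiv (X := C') hπ'.quotEquiv.symm ?_
      refine extClosed_filt _ (X := ModuleCat.of R (T ⧸ LinearMap.range ι)) a b hab hT.coker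
        (FiltSet.mono ?_ hN)
      simpa using hl₀.le
    · have : q ∘ₗ f = 0 := hN.hom_eq_zero' (by rintro _ rfl; exact h.hom _ _ hl₀) _
      obtain ⟨f', rfl⟩ := hjq.exists_lift f this
      obtain ⟨y, hy⟩ := hT.land f' x
      exact ⟨y, congrArg j hy⟩
    · obtain hl | hl := Nat.eq_or_lt_of_le hl
      · obtain rfl : l₀ = l := Fin.ext hl
        exact hext
      · exact .of_ses_right hjq (hT.ext l hl)
          (hN.extVanish_right (by rintro _ rfl; exact h.ext _ _ (Fin.lt_def.mpr hl)))

/-- The condition `hι` says that the image of ι lies in the summand Z. The new cokernel is then a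
summand of the old one, so summand closure applies. -/
lemma IsExtHull.of_retract [IsArtinianRing R] (h : ExtDirected Θ) {i : Fin t} {m : ℕ}
    {T Z : ModuleCat.{u} R} {ι : Θ i →ₗ[R] T} (hT : IsExtHull Θ i m T ι) {s : Z →ₗ[R] T}
    {r : T →ₗ[R] Z} (hr : r ∘ₗ s = LinearMap.id) (hι : s ∘ₗ r ∘ₗ ι = ι) :
    IsExtHull Θ i m Z (r ∘ₗ ι) := by
  have hι' : ∀ x, s (r (ι x)) = ι x := LinearMap.congr_fun hι
  refine ⟨fun x y hxy ↦ hT.inj ?_, h.retractClosed _ (IsRetract.quotient hr ?_ ?_) hT.coker,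
    fun f x ↦ ?_, fun l hl ↦ .of_retract_right ⟨s, r, hr⟩ (hT.ext l hl)⟩
  · rw [← hι', ← hι' y]
    exact congrArg s hxy
  · rintro _ ⟨x, rfl⟩
    exact ⟨x, (hι' x).symm⟩
  · rintro _ ⟨x, rfl⟩
    exact ⟨x, rfl⟩
  · obtain ⟨y, hy⟩ := hT.land (s ∘ₗ f) x
    exact ⟨y, (congrArg r hy).trans (apply_of_comp_eq_id hr _)⟩

/-- In any decomposition of T the copy of Θ(i) lies in one of the two summands; passing to that one
lowers the length. -/
lemma CoverData.exists_indecomposable_isExtHull [IsArtinianRing R] (k : Type*) [Field k]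
    [Algebra k R] [FiniteDimensional k R] (h : CoverData Θ P p) (i : Fin t) :
    ∃ (T : ModuleCat.{u} R) (ι : Θ i →ₗ[R] T), IsExtHull Θ i 0 T ι ∧ Indecomposable T := by
  suffices H : ∀ (T : ModuleCat.{u} R) (ι : Θ i →ₗ[R] T), IsExtHull Θ i 0 T ι →
      ∃ (T : ModuleCat.{u} R) (ι : Θ i →ₗ[R] T), IsExtHull Θ i 0 T ι ∧ Indecomposable T by
    obtain ⟨T, ι, hT⟩ := h.exists_isExtHull k i
    exact H T ι hT
  intro T
  induction hl : Module.length R T using WellFoundedLT.induction generalizing T with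
  | _ l ih =>
    intro ι hT
    by_cases hind : Indecomposable T
    · exact ⟨T, ι, hT, hind⟩
    have hTfin := hT.finite h.toExtDirected
    have := h.nontrivial i
    have : Nontrivial T := hT.inj.nontrivial
    have step : ∀ (Y Z : ModuleCat.{u} R) (s : Y →ₗ[R] T) (r : T →ₗ[R] Y) (s' : Z →ₗ[R] T),
        r ∘ₗ s = LinearMap.id → Function.Injective s' → r ∘ₗ s' = 0 → Nontrivial Z →
        s ∘ₗ r ∘ₗ ι = ι →
        ∃ (T : ModuleCat.{u} R) (ι : Θ i →ₗ[R] T), IsExtHull Θ i 0 T ι ∧ Indecomposable T := by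
      intro Y Z s r s' hr hs' h0 hZ hι
      refine ih _ ?_ Y rfl _ (hT.of_retract h.toExtDirected hr hι)
      rw [← hl, ← (r.quotKerEquivOfSurjective
        (Function.RightInverse.surjective (apply_of_comp_eq_id hr))).length_eq]
      refine Submodule.length_quotient_lt _ fun hk ↦ ?_
      obtain ⟨z, hz⟩ := exists_ne (0 : Z)
      have : s' z ∈ LinearMap.ker r := LinearMap.congr_fun h0 z
      rw [hk, Submodule.mem_bot] at this
      exact hz (hs' (this.trans (map_zero s').symm))
    by_contra hcon
    refine hind (indecomposable_of_idempotent fun Y Z s r s' r' hr hr' h1 h2 hsum ↦ ?_)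
    by_contra! hYZ
    obtain ⟨hY, hZ⟩ := hYZ
    have hrs := apply_of_comp_eq_id hr
    have hrs' := apply_of_comp_eq_id hr'
    -- By `land` the projection s ∘ r of T restricts to an idempotent f of Θ(i). As Θ(i) is local, f
    -- is 0 or 1.
    obtain ⟨f, hf⟩ := exists_cofactor hT.inj (s ∘ₗ r ∘ₗ ι) (hT.land _)
    have hf' : ∀ x, ι (f x) = s (r (ι x)) := LinearMap.congr_fun hf
    have hloc : IsLocalModule R (Θ i) := (h.local_proj i).of_surjective (h.surj i)
    rcases hloc.idempotent (f := f) (by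
      ext x
      apply hT.inj
      change ι (f (f x)) = ι (f x)
      rw [hf', hf', hrs]) with h0 | h0
    · refine hcon (step Z Y s' r' s hr' (Function.LeftInverse.injective hrs) h1 hY ?_)
      ext x
      have hx := LinearMap.congr_fun hsum (ι x)
      have hx0 : s (r (ι x)) = 0 := by rw [← hf', h0]; simp
      simpa [hx0] using hx
    · refine hcon (step Y Z s r s' hr (Function.LeftInverse.injective hrs') h2 hZ ?_)
      rw [← hf, h0, LinearMap.comp_id]

end CoverData

/-! ### Radicals of local modules and Fitting's lemma. -/

section LocalModules

variable {R : Type u} [Ring R] {X Y : Type u} [AddCommGroup X] [Module R X] [AddCommGroup Y]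
  [Module R Y]

lemma IsLocalModule.le_jacobson (h : IsLocalModule R X) {N : Submodule R X} (hN : N ≠ ⊤) :
    N ≤ Module.jacobson R X := by
  refine le_sInf fun m hm ↦ ?_
  have hm : IsCoatom m := hm
  rcases hm.le_iff.mp (le_sup_right : m ≤ N ⊔ m) with h1 | h1
  · exact absurd (h.2 _ _ h1) (by rintro (h | h); exacts [hN h, hm.1 h])
  · exact le_sup_left.trans h1.le

/-- A module of finite length without nontrivial direct sum decompositions is such that every
endomorphism is nilpotent or invertible. -/
lemma isNilpotent_or_bijective [IsArtinian R X] [IsNoetherian R X]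
    (hX : ∀ U V : Submodule R X, IsCompl U V → U = ⊥ ∨ V = ⊥) (f : Module.End R X) :
    IsNilpotent f ∨ Function.Bijective f := by
  obtain ⟨m, hm⟩ := Filter.eventually_atTop.mp f.eventually_isCompl_ker_pow_range_pow
  -- The exponent m + 1 is positive, so injectivity of the power passes to f.
  rcases hX _ _ (hm (m + 1) (Nat.le_succ m)) with h | h
  · right
    refine IsArtinian.bijective_of_injective_endomorphism f ?_
    have := LinearMap.ker_eq_bot.mp h
    rw [pow_succ] at this
    exact Function.Injective.of_comp (f := (f ^ m : Module.End R X)) this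
  · exact .inl ⟨m + 1, LinearMap.range_eq_bot.mp h⟩

lemma exists_simple_submodule [IsArtinian R X] [Nontrivial X] :
    ∃ U : Submodule R X, IsAtom U := by
  obtain ⟨U, hU, -⟩ := (eq_bot_or_exists_atom_le (⊤ : Submodule R X)).resolve_left top_ne_bot
  exact ⟨U, hU⟩

end LocalModules

/-! ### The projectives e_i A, their simple tops, and composition factors. -/

section Idempotents

open MulOpposite

variable {A : Type u} [Ring A] {n : ℕ} {e : Fin n → A}

lemma mul_mem_P {i : Fin n} {x : A} (hx : x ∈ Submodule.span Aᵐᵒᵖ {e i}) (a : A) :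
    x * a ∈ Submodule.span Aᵐᵒᵖ {e i} :=
  Submodule.smul_mem _ (op a) hx

lemma mul_of_mem_P {i : Fin n} (hi : IsIdempotentElem (e i)) {x : A}
    (hx : x ∈ Submodule.span Aᵐᵒᵖ {e i}) : e i * x = x := by
  obtain ⟨a, rfl⟩ := Submodule.mem_span_singleton.mp hx
  change e i * (e i * a.unop) = e i * a.unop
  rw [← mul_assoc, hi.eq]

variable (e) in
/-- The generator of `e i A`. -/
def gen (i : Fin n) : P e i := ⟨e i, Submodule.mem_span_singleton_self _⟩

lemma op_smul_gen {i : Fin n} (hi : IsIdempotentElem (e i)) (x : P e i) :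
    op x.1 • gen e i = x :=
  Subtype.ext (mul_of_mem_P hi x.2)

/-- The map `e i A → X` given by an element of `X`. -/
def ofElem (i : Fin n) {X : ModuleCat.{u} Aᵐᵒᵖ} (x : X) : P e i →ₗ[Aᵐᵒᵖ] X where
  toFun y := op y.1 • x
  map_add' y z := by rw [Submodule.coe_add, MulOpposite.op_add, add_smul]
  map_smul' a y := by
    rw [RingHom.id_apply, ← mul_smul]
    rfl

lemma ofElem_gen (i : Fin n) {X : ModuleCat.{u} Aᵐᵒᵖ} (x : X) :
    ofElem (e := e) i x (gen e i) = op (e i) • x := rfl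

lemma projective_P {i : Fin n} (hi : IsIdempotentElem (e i)) :
    Module.Projective Aᵐᵒᵖ (P e i) := by
  refine .of_split (M := Aᵐᵒᵖ) ⟨⟨fun x ↦ op x.1, fun _ _ ↦ rfl⟩, fun _ _ ↦ rfl⟩
    (LinearMap.toSpanSingleton _ _ (gen e i)) ?_
  ext x
  exact congrArg Subtype.val (op_smul_gen hi x)

instance finite_P (i : Fin n) : Module.Finite Aᵐᵒᵖ (P e i) := Module.Finite.span_singleton _ _

lemma exists_hom_P_ne_zero (he : CompleteOrthogonalIdempotents e) (X : ModuleCat.{u} Aᵐᵒᵖ)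
    [Nontrivial X] : ∃ (i : Fin n) (f : P e i →ₗ[Aᵐᵒᵖ] X), f ≠ 0 := by
  by_contra! H
  obtain ⟨x, hx⟩ := exists_ne (0 : X)
  refine hx ?_
  rw [← one_smul Aᵐᵒᵖ x, ← op_one, ← he.complete, Finset.op_sum, Finset.sum_smul]
  refine Finset.sum_eq_zero fun i _ ↦ ?_
  rw [← ofElem_gen, H i (ofElem i x), LinearMap.zero_apply]

/-- The right module `A` is the direct sum of the modules `e i A`. -/
lemma nonempty_equiv_pi_P (he : CompleteOrthogonalIdempotents e) :
    Nonempty ((∀ i, P e i) ≃ₗ[Aᵐᵒᵖ] A) := by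
  let F : (∀ i, P e i) →ₗ[Aᵐᵒᵖ] A :=
    ∑ i, (Submodule.subtype _) ∘ₗ LinearMap.proj (φ := fun i ↦ P e i) i
  have hF : ∀ x, F x = ∑ i, (x i).1 := fun x ↦ by simp [F]
  refine ⟨LinearEquiv.ofBijective F ⟨?_, fun a ↦ ⟨fun i ↦ ⟨e i * a,
    mul_mem_P (Submodule.mem_span_singleton_self _) a⟩, ?_⟩⟩⟩
  · rw [injective_iff_map_eq_zero]
    intro x hx
    ext i
    have h1 : e i * ∑ j, (x j).1 = 0 := by rw [← hF, hx, mul_zero]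
    rw [Finset.mul_sum, Finset.sum_eq_single i] at h1
    · rwa [mul_of_mem_P (he.idem i) (x i).2] at h1
    · intro j _ hji
      rw [← mul_of_mem_P (he.idem j) (x j).2, ← mul_assoc, he.ortho hji.symm, zero_mul]
    · simp
  · rw [hF, ← Finset.sum_mul, he.complete, one_mul]

/-- Writing e_i = u + v along U ⊕ V gives vu = u - uu in U ∩ V = 0, and likewise uv = 0. So u and v
are orthogonal idempotents and primitivity applies. -/
lemma isCompl_P {i : Fin n} (hi : IsPrimitiveIdempotent (e i)) (U V : Submodule Aᵐᵒᵖ (P e i))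
    (hUV : IsCompl U V) : U = ⊥ ∨ V = ⊥ := by
  obtain ⟨u, hu, v, hv, huv⟩ :=
    Submodule.mem_sup.mp (hUV.sup_eq_top ▸ Submodule.mem_top (x := gen e i))
  have huv' : u.1 + v.1 = e i := congrArg Subtype.val huv
  have top : ∀ W : Submodule Aᵐᵒᵖ (P e i), gen e i ∈ W → W = ⊤ := fun W hW ↦
    Submodule.eq_top_iff'.mpr fun x ↦ op_smul_gen hi.1 x ▸ W.smul_mem _ hW
  have split : ∀ z : P e i, u.1 * z.1 + v.1 * z.1 = z.1 := fun z ↦ by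
    rw [← add_mul, huv', mul_of_mem_P hi.1 z.2]
  have zero : ∀ z : P e i, z ∈ U → z ∈ V → z.1 = 0 := fun z h h' ↦
    congrArg Subtype.val (Submodule.disjoint_def.mp hUV.disjoint z h h')
  have hvu : v.1 * u.1 = 0 := by
    refine zero (op u.1 • v) ?_ (V.smul_mem _ hv)
    have : op u.1 • v = u - op u.1 • u := Subtype.ext (eq_sub_of_add_eq' (split u))
    rw [this]
    exact U.sub_mem hu (U.smul_mem _ hu)
  have huv0 : u.1 * v.1 = 0 := by
    refine zero (op v.1 • u) (U.smul_mem _ hu) ?_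
    have : op v.1 • u = v - op v.1 • v := Subtype.ext (eq_sub_of_add_eq (split v))
    rw [this]
    exact V.sub_mem hv (V.smul_mem _ hv)
  have huu : IsIdempotentElem u.1 := by
    have := split u
    rwa [hvu, add_zero] at this
  have hvv : IsIdempotentElem v.1 := by
    have := split v
    rwa [huv0, zero_add] at this
  rcases hi.2.2 u.1 v.1 huu hvv huv0 hvu huv' with h | h
  · left
    have : V = ⊤ := top V (by
      have h0 : u = 0 := Subtype.ext h
      rw [← huv, h0, zero_add]
      exact hv)
    have h1 := hUV.inf_eq_bot
    rwa [this, inf_top_eq] at h1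
  · right
    have : U = ⊤ := top U (by
      have h0 : v = 0 := Subtype.ext h
      rw [← huv, h0, add_zero]
      exact hu)
    have h1 := hUV.inf_eq_bot
    rwa [this, top_inf_eq] at h1

/-- If e_i = x + y with x in N and y in N', left multiplications by x and y on e_i A sum to the
identity. By Fitting one of them is bijective, and the submodule containing its image is everything.
-/
lemma isLocalModule_P [IsArtinianRing Aᵐᵒᵖ] {i : Fin n} (hi : IsPrimitiveIdempotent (e i)) :
    IsLocalModule Aᵐᵒᵖ (P e i) := by
  refine ⟨⟨gen e i, 0, fun h ↦ hi.2.1 (congrArg Subtype.val h)⟩, fun N N' hN ↦ ?_⟩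
  obtain ⟨x, hx, y, hy, hxy⟩ := Submodule.mem_sup.mp (hN ▸ Submodule.mem_top (x := gen e i))
  have hsum : ofElem (e := e) i x + ofElem (e := e) i y = LinearMap.id := by
    ext z
    refine congrArg Subtype.val (?_ : op z.1 • x + op z.1 • y = z)
    rw [← smul_add, hxy, op_smul_gen hi.1]
  have top : ∀ (W : Submodule Aᵐᵒᵖ (P e i)) (w : P e i), w ∈ W →
      Function.Surjective (ofElem (e := e) i w) → W = ⊤ := fun W w hw hs ↦ by
    refine Submodule.eq_top_iff'.mpr fun z ↦ ?_
    obtain ⟨z, rfl⟩ := hs z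
    exact W.smul_mem _ hw
  rcases isNilpotent_or_bijective (isCompl_P hi) (ofElem (e := e) i x) with h | h
  · right
    refine top N' y hy ?_
    have h1 : ofElem (e := e) i y = (1 : Module.End Aᵐᵒᵖ (P e i)) - ofElem (e := e) i x :=
      eq_sub_of_add_eq' hsum
    have h2 := IsNilpotent.isUnit_one_sub (R := Module.End Aᵐᵒᵖ (P e i)) h
    rw [← h1] at h2
    exact ((Module.End.isUnit_iff _).mp h2).2
  · exact .inl (top N x hx h.2)

/-- The map lifts to g : e_i A → e_j A. If g were onto it would split and, e_i A being local, be an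
isomorphism, against basicness; so g lands in the radical. -/
lemma hom_S_eq_zero [IsArtinianRing Aᵐᵒᵖ] (hprim : ∀ i, IsPrimitiveIdempotent (e i))
    (hbasic : ∀ i j, Nonempty (P e i ≅ P e j) → i = j) {i j : Fin n} (hij : i ≠ j)
    (f : P e i →ₗ[Aᵐᵒᵖ] S e j) : f = 0 := by
  by_contra hf
  have := projective_P (hprim i).1
  have := projective_P (hprim j).1
  have hloc := isLocalModule_P (hprim j)
  obtain ⟨g, rfl⟩ := Module.projective_lifting_property (Module.jacobson Aᵐᵒᵖ (P e j)).mkQ f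
    (Submodule.mkQ_surjective _)
  have hg : LinearMap.range g = ⊤ := by
    by_contra hg
    refine hf ?_
    ext x
    exact (Submodule.Quotient.mk_eq_zero _).mpr (hloc.le_jacobson hg ⟨x, rfl⟩)
  obtain ⟨s, hs⟩ := Module.projective_lifting_property g LinearMap.id (LinearMap.range_eq_top.mp hg)
  have hs' := apply_of_comp_eq_id hs
  rcases (isLocalModule_P (hprim i)).idempotent (f := s ∘ₗ g) (by ext x; simp [hs']) with h | h
  · refine hf ?_
    ext x
    have h1 : s (g x) = 0 := LinearMap.congr_fun h x
    have h2 := hs' (g x)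
    rw [h1, map_zero] at h2
    simp [← h2]
  · exact hij (hbasic i j ⟨(LinearEquiv.ofLinearMap g s hs h).toModuleIso⟩)

/-- The class `F(S(s))` consists of the finitely generated modules all of whose composition
factors are among the `S j` with `j ∈ s`. -/
lemma filtSet_S_iff [IsArtinianRing Aᵐᵒᵖ] (he : CompleteOrthogonalIdempotents e)
    (hprim : ∀ i, IsPrimitiveIdempotent (e i))
    (hbasic : ∀ i j, Nonempty (P e i ≅ P e j) → i = j) {s : Set (Fin n)}
    {X : ModuleCat.{u} Aᵐᵒᵖ} :
    FiltSet (S e) s X ↔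
      Module.Finite Aᵐᵒᵖ X ∧ ∀ j, j ∉ s → ∀ f : P e j →ₗ[Aᵐᵒᵖ] X, f = 0 := by
  constructor
  · refine fun h ↦ ⟨h.finite fun j _ ↦ inferInstance, fun j hj ↦ h.hom_eq_zero' fun l hl ↦ ?_⟩
    exact hom_S_eq_zero hprim hbasic (by rintro rfl; exact hj hl)
  rintro ⟨hfin, h⟩
  induction hl : Module.length Aᵐᵒᵖ X using WellFoundedLT.induction generalizing X with
  | _ l ih =>
    rcases subsingleton_or_nontrivial X with hX | hX
    · exact .of_subsingleton _
    obtain ⟨U, hU⟩ := exists_simple_submodule (R := Aᵐᵒᵖ) (X := X)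
    have : Nontrivial U := Submodule.nontrivial_iff_ne_bot.mpr hU.1
    -- A simple submodule U is hit by some P(j), and then U ≅ S(j); the hypothesis forces j into s.
    obtain ⟨j, f, hf⟩ := exists_hom_P_ne_zero he (ModuleCat.of Aᵐᵒᵖ U)
    have hj : j ∈ s := by
      by_contra hj
      refine hf ?_
      ext x
      exact LinearMap.congr_fun (h j hj (U.subtype ∘ₗ f)) x
    have := isSimpleModule_iff_isAtom.mpr hU
    have hfs : Function.Surjective f := (LinearMap.surjective_or_eq_zero f).resolve_right hf
    have hker : LinearMap.ker f = Module.jacobson Aᵐᵒᵖ (P e j) := by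
      refine le_antisymm ((isLocalModule_P (hprim j)).le_jacobson
        (LinearMap.ker_eq_top.not.mpr hf)) (sInf_le ?_)
      exact LinearMap.isCoatom_ker_of_surjective hfs
    have hUS : FiltSet (S e) s (ModuleCat.of Aᵐᵒᵖ U) :=
      Filt.of_equiv (X := S e j) ((Submodule.quotEquivOfEq _ _ hker.symm).trans
        (f.quotKerEquivOfSurjective hfs)) (filtSet_of_mem _ hj)
    refine extClosed_filt _ (X := ModuleCat.of Aᵐᵒᵖ U) (Z := ModuleCat.of Aᵐᵒᵖ (X ⧸ U)) _ _
      (isSES_submodule U) hUS (ih _ ?_ inferInstance (fun l hl g ↦ ?_) rfl)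
    · rw [← hl]
      exact Submodule.length_quotient_lt _ hU.1
    · have := projective_P (hprim l).1
      obtain ⟨g, rfl⟩ := Module.projective_lifting_property U.mkQ g U.mkQ_surjective
      rw [h l hl g, LinearMap.comp_zero]

end Idempotents

/-! ### Standard and proper standard modules through their maximality. -/

section StandardModules

variable {A : Type u} [Ring A] {n : ℕ} {e : Fin n → A}

/-- A map from the jacobson radical of `X` to that of `Y` induced by a map from `X` to `Y`. -/
def jacobsonMap {R : Type u} [Ring R] {X Y : Type u} [AddCommGroup X] [Module R X]
    [AddCommGroup Y] [Module R Y] (f : X →ₗ[R] Y) :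
    Module.jacobson R X →ₗ[R] Module.jacobson R Y :=
  f.restrict fun _ hx ↦ Module.le_comap_jacobson f hx

/-- A surjection `e i A → X` with the properties shared by the projections onto the standard
and the proper standard module. -/
structure IsStandardCover (e : Fin n → A) (i : Fin n) (X : ModuleCat.{u} Aᵐᵒᵖ)
    (p : P e i →ₗ[Aᵐᵒᵖ] X) : Prop where
  surj : Function.Surjective p
  nontrivial : Nontrivial X
  hom : ∀ j, i < j → ∀ f : P e j →ₗ[Aᵐᵒᵖ] X, f = 0
  -- This expresses that the top of ker p involves only S(j) with j ≥ i.
  ker_hom : ∀ Y : ModuleCat.{u} Aᵐᵒᵖ, (∀ j, i ≤ j → ∀ f : P e j →ₗ[Aᵐᵒᵖ] Y, f = 0) →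
    ∀ f : LinearMap.ker p →ₗ[Aᵐᵒᵖ] Y, f = 0
  -- The first alternative (the top of ker p involves only j > i) is the standard case and yields a
  -- stone; the second is the proper standard case and yields a brick.
  type : (∀ Y : ModuleCat.{u} Aᵐᵒᵖ, (∀ j, i < j → ∀ f : P e j →ₗ[Aᵐᵒᵖ] Y, f = 0) →
      ∀ f : LinearMap.ker p →ₗ[Aᵐᵒᵖ] Y, f = 0) ∨
    ∀ f : P e i →ₗ[Aᵐᵒᵖ] X, f ≠ 0 → Function.Surjective f

lemma IsStandardCover.of_equiv {i : Fin n} {X Y : ModuleCat.{u} Aᵐᵒᵖ} {p : P e i →ₗ[Aᵐᵒᵖ] X}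
    (h : IsStandardCover e i X p) (φ : X ≃ₗ[Aᵐᵒᵖ] Y) :
    IsStandardCover e i Y (φ.toLinearMap ∘ₗ p) := by
  have key : ∀ {W : ModuleCat.{u} Aᵐᵒᵖ} (f : W →ₗ[Aᵐᵒᵖ] Y), φ.symm.toLinearMap ∘ₗ f = 0 → f = 0 :=
    fun f hf ↦ by
      ext x
      exact φ.symm.injective ((LinearMap.congr_fun hf x).trans (map_zero φ.symm).symm)
  have hker : LinearMap.ker (φ.toLinearMap ∘ₗ p) = LinearMap.ker p := LinearEquiv.ker_comp φ p
  refine ⟨φ.surjective.comp h.surj, @Function.Injective.nontrivial _ _ h.nontrivial _ φ.injective,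
    fun j hj f ↦ key f (h.hom j hj _), ?_, ?_⟩
  · rw [hker]
    exact h.ker_hom
  · rw [hker]
    refine h.type.imp_right fun H f hf ↦ ?_
    have := φ.surjective.comp (H (φ.symm.toLinearMap ∘ₗ f) (mt (key f) hf))
    intro y
    obtain ⟨x, hx⟩ := this y
    exact ⟨x, by simpa using hx⟩

/-- Let `p : Q → X` be surjective and `f : ker p → Y`. Then `p` factors as `Q → Z → X`, where
`Z = Q / ker f` is an extension of `X` by the image of `f`. -/
lemma exists_quotient_of_hom_ker {R : Type u} [Ring R] {Q X Y : ModuleCat.{u} R} {p : Q →ₗ[R] X}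
    (hp : Function.Surjective p) (f : LinearMap.ker p →ₗ[R] Y) :
    ∃ (Z : ModuleCat.{u} R) (π : Q →ₗ[R] Z) (ρ : Z →ₗ[R] X), Function.Surjective π ∧ ρ ∘ₗ π = p ∧
      (∀ x : LinearMap.ker p, π x = 0 → f x = 0) ∧
      ∀ (W : ModuleCat.{u} R) (g : W →ₗ[R] Z), ρ ∘ₗ g = 0 → (∀ h : W →ₗ[R] Y, h = 0) → g = 0 := by
  obtain ⟨Z, j, ρ, π, hjρ, hπ, hρ⟩ := (isSES_ker hp).exists_pushout f.rangeRestrict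
  refine ⟨Z, π, ρ, ?_, hρ, fun x hx ↦ ?_, fun W g hg hW ↦ ?_⟩
  · intro z
    obtain ⟨x, hx⟩ := hp (ρ z)
    have hx' : ρ (π x) = ρ z := (LinearMap.congr_fun hρ x).trans hx
    obtain ⟨⟨_, y, rfl⟩, hy⟩ := (hjρ.exact (z - π x)).mp (by rw [map_sub, hx', sub_self])
    refine ⟨x + y.1, ?_⟩
    have h1 : π y.1 = j (f.rangeRestrict y) := LinearMap.congr_fun hπ y
    have h2 : j (f.rangeRestrict y) = z - π x := hy
    rw [map_add, h1, h2, add_sub_cancel]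
  · have h1 : π x.1 = j (f.rangeRestrict x) := LinearMap.congr_fun hπ x
    rw [hx] at h1
    exact congrArg Subtype.val (hjρ.inj (h1.symm.trans (map_zero j).symm))
  · obtain ⟨g', rfl⟩ := hjρ.exists_lift g hg
    have h1 := hW ((LinearMap.range f).subtype ∘ₗ g')
    have : g' = 0 := by
      ext w
      exact LinearMap.congr_fun h1 w
    rw [this, LinearMap.comp_zero]

variable [IsArtinianRing Aᵐᵒᵖ]

/-- An element of Δ(i) vanishes once it vanishes in every quotient e_i A / N of the defining family,
and these receive no maps from P(j). Attainment of the infimum is not needed. -/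
lemma hom_P_standard (he : CompleteOrthogonalIdempotents e)
    (hprim : ∀ i, IsPrimitiveIdempotent (e i))
    (hbasic : ∀ i j, Nonempty (P e i ≅ P e j) → i = j) {i j : Fin n} (hij : i < j)
    (f : P e j →ₗ[Aᵐᵒᵖ] standard e i) : f = 0 := by
  ext x
  obtain ⟨y, hy⟩ := Submodule.mkQ_surjective _ (f x)
  rw [← hy]
  refine (Submodule.Quotient.mk_eq_zero _).mpr (Submodule.mem_sInf.mpr fun N hN ↦ ?_)
  have hle : standardKernel e i ≤ N := sInf_le hN
  have h0 := ((filtSet_S_iff he hprim hbasic).mp hN).2 j (by simpa using hij)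
    (Submodule.mapQ _ N LinearMap.id hle ∘ₗ f)
  have := LinearMap.congr_fun h0 x
  rw [LinearMap.comp_apply, ← hy] at this
  exact (Submodule.Quotient.mk_eq_zero N).mp this

/-- Maximality of Δ(i): the image of f is a quotient of e_i A without factors S(j), j > i, so ker f
belongs to the defining family. -/
lemma standardKernel_le_ker (he : CompleteOrthogonalIdempotents e)
    (hprim : ∀ i, IsPrimitiveIdempotent (e i))
    (hbasic : ∀ i j, Nonempty (P e i ≅ P e j) → i = j) {i : Fin n} {X : ModuleCat.{u} Aᵐᵒᵖ}
    (hX : ∀ j, i < j → ∀ f : P e j →ₗ[Aᵐᵒᵖ] X, f = 0) (f : P e i →ₗ[Aᵐᵒᵖ] X) :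
    standardKernel e i ≤ LinearMap.ker f := by
  refine sInf_le ((filtSet_S_iff he hprim hbasic).mpr ⟨inferInstance, fun j hj g ↦ ?_⟩)
  have h0 := hX j (by simpa using hj) ((LinearMap.ker f).liftQ f le_rfl ∘ₗ g)
  ext x
  have hinj : Function.Injective ((LinearMap.ker f).liftQ f le_rfl) :=
    LinearMap.ker_eq_bot.mp (Submodule.ker_liftQ_eq_bot _ _ _ le_rfl)
  exact hinj ((LinearMap.congr_fun h0 x).trans (map_zero _).symm)

lemma properStandardKernel_le_ker (he : CompleteOrthogonalIdempotents e)
    (hprim : ∀ i, IsPrimitiveIdempotent (e i))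
    (hbasic : ∀ i j, Nonempty (P e i ≅ P e j) → i = j) {i : Fin n} {Y : ModuleCat.{u} Aᵐᵒᵖ}
    (hY : ∀ j, i ≤ j → ∀ f : P e j →ₗ[Aᵐᵒᵖ] Module.jacobson Aᵐᵒᵖ Y, f = 0)
    {q : standard e i →ₗ[Aᵐᵒᵖ] Y} (hq : Function.Surjective q) :
    properStandardKernel e i ≤ LinearMap.ker q := by
  have : IsNoetherian Aᵐᵒᵖ (standard e i ⧸ LinearMap.ker q) := inferInstance
  refine sInf_le ((filtSet_S_iff he hprim hbasic).mpr ⟨inferInstance, fun j hj g ↦ ?_⟩)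
  let φ := q.quotKerEquivOfSurjective hq
  have h0 := hY j (by simpa using hj) (jacobsonMap φ.toLinearMap ∘ₗ g)
  ext x
  exact φ.injective ((congrArg Subtype.val (LinearMap.congr_fun h0 x)).trans (map_zero φ).symm)

lemma hom_P_jacobson_properStandard (he : CompleteOrthogonalIdempotents e)
    (hprim : ∀ i, IsPrimitiveIdempotent (e i))
    (hbasic : ∀ i j, Nonempty (P e i ≅ P e j) → i = j) {i j : Fin n} (hij : i ≤ j)
    (f : P e j →ₗ[Aᵐᵒᵖ] Module.jacobson Aᵐᵒᵖ (properStandard e i)) : f = 0 := by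
  ext x
  obtain ⟨y, hy⟩ := Submodule.mkQ_surjective _ (f x).1
  change (f x).1 = 0
  rw [← hy]
  refine (Submodule.Quotient.mk_eq_zero _).mpr (Submodule.mem_sInf.mpr fun N hN ↦ ?_)
  have hle : properStandardKernel e i ≤ N := sInf_le hN
  have h0 := ((filtSet_S_iff he hprim hbasic).mp hN).2 j (by simpa using hij)
    (jacobsonMap (Submodule.mapQ _ N LinearMap.id hle) ∘ₗ f)
  have : Submodule.mapQ _ N LinearMap.id hle (f x).1 = 0 :=
    congrArg Subtype.val (LinearMap.congr_fun h0 x)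
  rw [← hy] at this
  exact (Submodule.Quotient.mk_eq_zero N).mp this

lemma mkQ_jacobson_ne_zero (hprim : ∀ i, IsPrimitiveIdempotent (e i)) (i : Fin n) :
    (Module.jacobson Aᵐᵒᵖ (P e i)).mkQ ≠ 0 := by
  intro h
  have := (isLocalModule_P (hprim i)).1
  have h1 := Submodule.ker_mkQ (Module.jacobson Aᵐᵒᵖ (P e i))
  rw [h, LinearMap.ker_zero] at h1
  exact (Module.jacobson_lt_top Aᵐᵒᵖ (P e i)).ne h1.symm

/-- S(i) is a quotient of Δ(i) with zero radical, hence a quotient of the proper standard module. -/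
lemma nontrivial_properStandard (he : CompleteOrthogonalIdempotents e)
    (hprim : ∀ i, IsPrimitiveIdempotent (e i))
    (hbasic : ∀ i j, Nonempty (P e i ≅ P e j) → i = j) (i : Fin n) :
    Nontrivial (properStandard e i) := by
  have hS : ∀ j, i < j → ∀ f : P e j →ₗ[Aᵐᵒᵖ] S e i, f = 0 :=
    fun j hij f ↦ hom_S_eq_zero hprim hbasic hij.ne' f
  let q : standard e i →ₗ[Aᵐᵒᵖ] S e i := Submodule.liftQ _ (Submodule.mkQ _)
    (standardKernel_le_ker he hprim hbasic hS _)
  have hq : Function.Surjective q := fun x ↦ by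
    obtain ⟨y, rfl⟩ := Submodule.mkQ_surjective _ x
    exact ⟨Submodule.mkQ _ y, rfl⟩
  have hle := properStandardKernel_le_ker he hprim hbasic (Y := S e i) (fun j _ f ↦ by
    ext x
    exact (Submodule.mem_bot _).mp
      ((Module.jacobson_quotient_jacobson Aᵐᵒᵖ (P e i)).le (f x).2)) hq
  refine Submodule.Quotient.nontrivial_iff.mpr fun htop ↦ ?_
  rw [htop, top_le_iff, LinearMap.ker_eq_top] at hle
  refine mkQ_jacobson_ne_zero hprim i ?_
  ext x
  exact LinearMap.congr_fun hle (Submodule.mkQ _ x)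

lemma nontrivial_standard (he : CompleteOrthogonalIdempotents e)
    (hprim : ∀ i, IsPrimitiveIdempotent (e i))
    (hbasic : ∀ i j, Nonempty (P e i ≅ P e j) → i = j) (i : Fin n) :
    Nontrivial (standard e i) := by
  have := nontrivial_properStandard he hprim hbasic i
  exact (Submodule.mkQ_surjective (properStandardKernel e i)).nontrivial

/-- A map f from the kernel to Y gives a quotient Z of e_i A that extends Δ(i) by the image of f. If
Y has no factors S(j) with j > i, then neither has Z, and maximality of Δ(i) forces f = 0. -/
lemma isStandardCover_standard (he : CompleteOrthogonalIdempotents e)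
    (hprim : ∀ i, IsPrimitiveIdempotent (e i))
    (hbasic : ∀ i j, Nonempty (P e i ≅ P e j) → i = j) (i : Fin n) :
    IsStandardCover e i (standard e i) (standardKernel e i).mkQ := by
  have key : ∀ Y : ModuleCat.{u} Aᵐᵒᵖ, (∀ j, i < j → ∀ f : P e j →ₗ[Aᵐᵒᵖ] Y, f = 0) →
      ∀ f : LinearMap.ker (standardKernel e i).mkQ →ₗ[Aᵐᵒᵖ] Y, f = 0 := by
    intro Y hY f
    obtain ⟨Z, π, ρ, hπ, hρ, hf, hZ⟩ := exists_quotient_of_hom_ker (X := standard e i) (Y := Y)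
      (Submodule.mkQ_surjective _) f
    have hle := standardKernel_le_ker he hprim hbasic (X := Z)
      (fun j hj g ↦ hZ (P e j) g (hom_P_standard he hprim hbasic hj _) (hY j hj)) π
    ext x
    exact hf x (hle ((Submodule.Quotient.mk_eq_zero _).mp x.2))
  exact ⟨Submodule.mkQ_surjective _, nontrivial_standard he hprim hbasic i,
    fun j hj f ↦ hom_P_standard he hprim hbasic hj f,
    fun Y hY ↦ key Y fun j hj ↦ hY j hj.le, .inl key⟩

lemma isStandardCover_properStandard (he : CompleteOrthogonalIdempotents e)
    (hprim : ∀ i, IsPrimitiveIdempotent (e i))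
    (hbasic : ∀ i j, Nonempty (P e i ≅ P e j) → i = j) (i : Fin n) :
    IsStandardCover e i (properStandard e i)
      ((properStandardKernel e i).mkQ ∘ₗ (standardKernel e i).mkQ) := by
  have hsurj : Function.Surjective
      ((properStandardKernel e i).mkQ ∘ₗ (standardKernel e i).mkQ) :=
    (Submodule.mkQ_surjective _).comp (Submodule.mkQ_surjective _)
  have hom : ∀ j, i < j → ∀ f : P e j →ₗ[Aᵐᵒᵖ] properStandard e i, f = 0 := by
    intro j hj f
    have := projective_P (hprim j).1
    obtain ⟨f, rfl⟩ := Module.projective_lifting_property (properStandardKernel e i).mkQ f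
      (Submodule.mkQ_surjective _)
    rw [hom_P_standard he hprim hbasic hj f, LinearMap.comp_zero]
  refine ⟨hsurj, nontrivial_properStandard he hprim hbasic i, hom, fun Y hY f ↦ ?_,
    .inr fun f hf ↦ ?_⟩
  · obtain ⟨Z, π, ρ, hπ, hρ, hf, hZ⟩ := exists_quotient_of_hom_ker (X := properStandard e i)
      (Y := Y) hsurj f
    have hle := standardKernel_le_ker he hprim hbasic (X := Z)
      (fun j hj g ↦ hZ (P e j) g (hom j hj _) (hY j hj.le)) π
    have hq : Function.Surjective ((standardKernel e i).liftQ π hle) := fun z ↦ by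
      obtain ⟨x, rfl⟩ := hπ z
      exact ⟨Submodule.mkQ _ x, rfl⟩
    -- A map P(j) → rad Z with j ≥ i dies in the radical of the proper standard module, so it lands
    -- in the image of f, where Hom(P(j), Y) = 0 kills it.
    have hle' := properStandardKernel_le_ker he hprim hbasic (Y := Z) (fun j hj g ↦ by
      have h1 := hom_P_jacobson_properStandard he hprim hbasic hj (jacobsonMap ρ ∘ₗ g)
      have h2 := hZ (P e j) ((Module.jacobson Aᵐᵒᵖ Z).subtype ∘ₗ g)
        (congrArg ((Module.jacobson Aᵐᵒᵖ (properStandard e i)).subtype ∘ₗ ·) h1) (hY j hj)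
      ext x
      exact LinearMap.congr_fun h2 x) hq
    ext x
    exact hf x (hle' ((Submodule.Quotient.mk_eq_zero _).mp x.2))
  · by_contra hs
    have hloc : IsLocalModule Aᵐᵒᵖ (properStandard e i) :=
      have := nontrivial_properStandard he hprim hbasic i
      (isLocalModule_P (hprim i)).of_surjective hsurj
    have hr := hloc.le_jacobson (mt LinearMap.range_eq_top.mp hs)
    have h0 := hom_P_jacobson_properStandard he hprim hbasic le_rfl
      (f.codRestrict _ fun x ↦ hr ⟨x, rfl⟩)
    refine hf ?_
    ext x
    exact congrArg Subtype.val (LinearMap.congr_fun h0 x)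

lemma exists_isStandardCover (he : CompleteOrthogonalIdempotents e)
    (hprim : ∀ i, IsPrimitiveIdempotent (e i))
    (hbasic : ∀ i j, Nonempty (P e i ≅ P e j) → i = j) {i : Fin n} {X : ModuleCat.{u} Aᵐᵒᵖ}
    (hX : Nonempty (X ≅ standard e i) ∨ Nonempty (X ≅ properStandard e i)) :
    ∃ p : P e i →ₗ[Aᵐᵒᵖ] X, IsStandardCover e i X p := by
  rcases hX with ⟨⟨φ⟩⟩ | ⟨⟨φ⟩⟩
  · exact ⟨_, (isStandardCover_standard he hprim hbasic i).of_equiv φ.toLinearEquiv.symm⟩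
  · exact ⟨_, (isStandardCover_properStandard he hprim hbasic i).of_equiv φ.toLinearEquiv.symm⟩

end StandardModules

/-! ### The implications between the three conditions. -/

section Equivalences

/-- Modules of finite length that surject onto each other are isomorphic. -/
lemma nonempty_iso_of_surjective {R : Type u} [Ring R] {X Y : ModuleCat.{u} R} [IsNoetherian R X]
    {f : X →ₗ[R] Y} {g : Y →ₗ[R] X} (hf : Function.Surjective f) (hg : Function.Surjective g) :
    Nonempty (X ≅ Y) := by
  have h := IsNoetherian.injective_of_surjective_endomorphism (g ∘ₗ f) (hg.comp hf)
  exact ⟨(LinearEquiv.ofBijective f ⟨Function.Injective.of_comp (f := g) h, hf⟩).toModuleIso⟩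

/-- The maps `X → Y` that are sums of maps factoring through `Z`. -/
def factorSubgroup {R : Type u} [Ring R] (X Y Z : ModuleCat.{u} R) : AddSubgroup (X →ₗ[R] Y) :=
  AddSubgroup.closure {f | ∃ (a : X →ₗ[R] Z) (b : Z →ₗ[R] Y), f = b ∘ₗ a}

/-- If `Ext¹(Θ j, Θ i) = 0` for all `j ∈ s` and `X` receives no maps from the other members of
`Θ(s)`, then every map from a module filtered by `Θ(s)` to `X` is a sum of maps through `Θ i`. -/
lemma FiltSet.mem_factorSubgroup {R : Type u} [Ring R] {t : ℕ} {Θ : Fin t → ModuleCat.{u} R}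
    {s : Set (Fin t)} {i : Fin t} (hext : ∀ j ∈ s, ExtVanish R (Θ j) (Θ i)) {X : ModuleCat.{u} R}
    (hX : ∀ j ∈ s, j ≠ i → ∀ f : Θ j →ₗ[R] X, f = 0) {M : ModuleCat.{u} R} (hM : FiltSet Θ s M)
    (g : M →ₗ[R] X) : g ∈ factorSubgroup M X (Θ i) := by
  have key : ∀ {M : ModuleCat.{u} R}, InAdd (dsum Θ s) M → ∀ g : M →ₗ[R] X,
      g ∈ factorSubgroup M X (Θ i) := by
    intro M hM g
    obtain ⟨ι, _, c, α, β, hαβ⟩ := hM.exists_sum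
    have hg : g = ∑ l, (g ∘ₗ β l) ∘ₗ α l := by
      ext x
      conv_lhs => rw [← LinearMap.id_apply (R := R) x, ← hαβ, LinearMap.sum_apply, map_sum]
      rw [LinearMap.sum_apply]
      rfl
    have hj : ∀ j ∈ s, ∀ (a : M →ₗ[R] Θ j) (b : Θ j →ₗ[R] X),
        b ∘ₗ a ∈ factorSubgroup M X (Θ i) := by
      intro j hj a b
      by_cases hji : j = i
      · subst hji
        exact AddSubgroup.subset_closure ⟨a, b, rfl⟩
      · rw [hX j hj hji b, LinearMap.zero_comp]
        exact zero_mem _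
    rw [hg]
    exact sum_mem fun l _ ↦ hj _ (c l).2 _ _
  induction hM with
  | of_inAdd hM => exact key hM g
  | @ext M₁ M Z f π w hex hM₁ hZ ih =>
    have hfπ := isSES_of_shortExact hex
    have hZi : ExtVanish R Z (Θ i) := hZ.extVanish_left hext
    have hlift : ∀ u ∈ factorSubgroup M₁ X (Θ i), ∃ v ∈ factorSubgroup M X (Θ i),
        v ∘ₗ f.hom = u := by
      intro u hu
      induction hu using AddSubgroup.closure_induction with
      | mem u hu =>
        obtain ⟨a, b, rfl⟩ := hu
        obtain ⟨a', rfl⟩ := hZi.exists_extend hfπ a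
        exact ⟨b ∘ₗ a', AddSubgroup.subset_closure ⟨a', b, rfl⟩, rfl⟩
      | zero => exact ⟨0, zero_mem _, LinearMap.zero_comp _⟩
      | add u u' _ _ hu hu' =>
        obtain ⟨v, hv, rfl⟩ := hu
        obtain ⟨v', hv', rfl⟩ := hu'
        exact ⟨v + v', add_mem hv hv', LinearMap.add_comp _ _ _⟩
      | neg u _ hu =>
        obtain ⟨v, hv, rfl⟩ := hu
        exact ⟨-v, neg_mem hv, LinearMap.neg_comp _ _⟩
    have hdesc : ∀ u ∈ factorSubgroup Z X (Θ i), u ∘ₗ π.hom ∈ factorSubgroup M X (Θ i) := by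
      intro u hu
      induction hu using AddSubgroup.closure_induction with
      | mem u hu =>
        obtain ⟨a, b, rfl⟩ := hu
        exact AddSubgroup.subset_closure ⟨a ∘ₗ π.hom, b, rfl⟩
      | zero => rw [LinearMap.zero_comp]; exact zero_mem _
      | add u u' _ _ hu hu' => rw [LinearMap.add_comp]; exact add_mem hu hu'
      | neg u _ hu => rw [LinearMap.neg_comp]; exact neg_mem hu
    obtain ⟨v, hv, hvf⟩ := hlift _ (ih (g ∘ₗ f.hom))
    obtain ⟨z, hz⟩ := hfπ.exists_desc (g - v) (by rw [LinearMap.sub_comp, hvf, sub_self])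
    rw [← sub_add_cancel g v, ← hz]
    exact add_mem (hdesc z (key hZ z)) hv

variable {A : Type u} [Ring A] {n : ℕ} {e : Fin n → A} {Θ : Fin n → ModuleCat.{u} Aᵐᵒᵖ}

lemma CoverData.filtSet_P {p : ∀ i, P e i →ₗ[Aᵐᵒᵖ] Θ i} (h : CoverData Θ (P e) p) (i : Fin n) :
    FiltSet Θ (Set.Ici i) (P e i) :=
  extClosed_filt _ (X := ModuleCat.of Aᵐᵒᵖ (LinearMap.ker (p i))) _ _ (isSES_ker (h.surj i))
    (h.ker_mem i) (filtSet_of_mem Θ Set.self_mem_Ici)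

variable [IsArtinianRing Aᵐᵒᵖ]

/-- The kernel K(i) is filtered by Θ(≥ i), so it has no maps to Θ(j) for j < i; this gives
Ext¹(Θ(i), Θ(j)) = 0. -/
lemma IsMixedStratifyingSystem.exists_coverData (hprim : ∀ i, IsPrimitiveIdempotent (e i))
    (h : IsMixedStratifyingSystem Θ (P e)) : ∃ p, CoverData Θ (P e) p := by
  choose K f g w hse hK using h.conflation
  have hses := fun i ↦ isSES_of_shortExact (hse i)
  have hom : ∀ i j, j < i → ∀ f : Θ i →ₗ[Aᵐᵒᵖ] Θ j, f = 0 := fun i j hij f ↦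
    congrArg ModuleCat.Hom.hom (h.hom_eq_zero i j hij (ModuleCat.ofHom f))
  have hP : ∀ i, FiltSet Θ (Set.Ici i) (P e i) := fun i ↦
    extClosed_filt _ _ _ (hses i) (hK i) (filtSet_of_mem Θ Set.self_mem_Ici)
  have hproj := fun i ↦ projective_P (hprim i).1
  refine ⟨fun i ↦ (g i).hom, ⟨h.finite_left, hom, fun i j hij ↦ ?_,
    fun i ↦ (h.brick_or_stone i).imp_right fun h ↦ h.2⟩, h.finite_right,
    hproj, fun i ↦ isLocalModule_P (hprim i), fun i ↦ (hses i).surj,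
    fun i ↦ ?_, fun i ↦ ?_, fun i j hij ↦ ?_⟩
  · have := hproj i
    refine extVanish_of_extend (hses i) fun u ↦ ⟨0, ?_⟩
    rw [FiltSet.hom_eq_zero (hK i) (fun l hl ↦ hom l j (hij.trans_le hl)) u, LinearMap.zero_comp]
  · rcases h.brick_or_stone i with hi | hi
    · exact hi.nontrivial
    · by_contra hn
      rw [not_nontrivial_iff_subsingleton] at hn
      exact hi.1.1 (ModuleCat.isZero_of_subsingleton _)
  · have e1 := LinearEquiv.ofInjective (f i).hom (hses i).inj
    rw [← (hses i).ker_eq] at e1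
    exact Filt.of_equiv (X := K i) e1 (hK i)
  · exact (hP i).hom_eq_zero fun l hl ↦ hom l j (hij.trans_le hl)

/-- In a mixed stratifying system `(Θ, A)`, a brick `Θ i` is the proper standard module. -/
lemma CoverData.iso_properStandard (he : CompleteOrthogonalIdempotents e)
    (hprim : ∀ i, IsPrimitiveIdempotent (e i))
    (hbasic : ∀ i j, Nonempty (P e i ≅ P e j) → i = j) {p : ∀ i, P e i →ₗ[Aᵐᵒᵖ] Θ i}
    (h : CoverData Θ (P e) p) {i : Fin n} (hi : IsBrick (Θ i)) :
    Nonempty (Θ i ≅ properStandard e i) := by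
  have := h.finite i
  have := h.nontrivial i
  have hsurj : ∀ f : P e i →ₗ[Aᵐᵒᵖ] Θ i, f ≠ 0 → Function.Surjective f := fun f hf ↦
    ((h.filtSet_P i).ker_of_brick hi
      (fun j hj hji ↦ h.hom j i (lt_of_le_of_ne hj hji.symm)) hf).1
  have hle := standardKernel_le_ker he hprim hbasic (fun j hj ↦ h.hom_proj j i hj) (p i)
  let q : standard e i →ₗ[Aᵐᵒᵖ] Θ i := (standardKernel e i).liftQ (p i) hle
  have hq : Function.Surjective q := fun y ↦ by
    obtain ⟨x, rfl⟩ := h.surj i y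
    exact ⟨Submodule.mkQ _ x, rfl⟩
  -- Nonzero maps P(i) → Θ(i) are onto, so none lands in the radical; hence rad Θ(i) has no factor
  -- S(j) with j ≥ i.
  have hle' : properStandardKernel e i ≤ LinearMap.ker q := by
    refine properStandardKernel_le_ker he hprim hbasic (fun j hij f ↦ ?_) hq
    have h0 : (Module.jacobson Aᵐᵒᵖ (Θ i)).subtype ∘ₗ f = 0 := by
      obtain rfl | hij := hij.eq_or_lt
      · by_contra hne
        refine (Module.jacobson_lt_top Aᵐᵒᵖ (Θ i)).ne (eq_top_iff.mpr fun y _ ↦ ?_)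
        obtain ⟨x, rfl⟩ := hsurj _ hne y
        exact (f x).2
      · exact h.hom_proj j i hij _
    ext x
    exact LinearMap.congr_fun h0 x
  have hq' : Function.Surjective ((properStandardKernel e i).liftQ q hle') := fun y ↦ by
    obtain ⟨x, rfl⟩ := hq y
    exact ⟨Submodule.mkQ _ x, rfl⟩
  let π : P e i →ₗ[Aᵐᵒᵖ] properStandard e i :=
    (properStandardKernel e i).mkQ ∘ₗ (standardKernel e i).mkQ
  have hπ : Function.Surjective π := (Submodule.mkQ_surjective _).comp (Submodule.mkQ_surjective _)
  -- For the converse surjection: ker (p i) is filtered by Θ(≥ i) and maps into the radical of the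
  -- proper standard module, which receives no maps from Θ(j), j ≥ i.
  have hker : ∀ x, p i x = 0 → π x = 0 := by
    have hrad : ∀ x : LinearMap.ker (p i), π x.1 ∈ Module.jacobson Aᵐᵒᵖ (properStandard e i) :=
      fun x ↦ Module.le_comap_jacobson π
        ((isLocalModule_P (hprim i)).le_jacobson (h.ker_ne_top i) x.2)
    have h0 := (h.ker_mem i).hom_eq_zero
      (W := ModuleCat.of Aᵐᵒᵖ (Module.jacobson Aᵐᵒᵖ (properStandard e i))) (fun j hj f ↦ by
        have := hom_P_jacobson_properStandard he hprim hbasic hj (f ∘ₗ p j)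
        ext y
        obtain ⟨x, rfl⟩ := h.surj j y
        exact congrArg Subtype.val (LinearMap.congr_fun this x))
      ((π ∘ₗ (LinearMap.ker (p i)).subtype).codRestrict _ hrad)
    exact fun x hx ↦ congrArg Subtype.val (LinearMap.congr_fun h0 ⟨x, hx⟩)
  obtain ⟨π', hπ'⟩ := exists_factor (h.surj i) π hker
  refine nonempty_iso_of_surjective (f := π') (fun y ↦ ?_) hq'
  obtain ⟨x, rfl⟩ := hπ y
  exact ⟨p i x, LinearMap.congr_fun hπ' x⟩

/-- In a mixed stratifying system `(Θ, A)`, if `Θ i` has no self-extensions, then it is the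
standard module. -/
lemma CoverData.iso_standard (he : CompleteOrthogonalIdempotents e)
    (hprim : ∀ i, IsPrimitiveIdempotent (e i))
    (hbasic : ∀ i j, Nonempty (P e i ≅ P e j) → i = j) {p : ∀ i, P e i →ₗ[Aᵐᵒᵖ] Θ i}
    (h : CoverData Θ (P e) p) {i : Fin n} (hi : ExtVanish Aᵐᵒᵖ (Θ i) (Θ i)) :
    Nonempty (Θ i ≅ standard e i) := by
  have := h.finite i
  have := nontrivial_standard he hprim hbasic i
  have hle := standardKernel_le_ker he hprim hbasic (fun j hj ↦ h.hom_proj j i hj) (p i)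
  have hq : Function.Surjective ((standardKernel e i).liftQ (p i) hle) := fun y ↦ by
    obtain ⟨x, rfl⟩ := h.surj i y
    exact ⟨Submodule.mkQ _ x, rfl⟩
  have hmem : (standardKernel e i).mkQ ∈ factorSubgroup (P e i) (standard e i) (Θ i) := by
    refine (h.filtSet_P i).mem_factorSubgroup (fun j hj ↦ ?_) (fun j hj hji f ↦ ?_) _
    · obtain rfl | hij := (show i ≤ j from hj).eq_or_lt
      · exact hi
      · exact h.ext j i hij
    · have h0 := hom_P_standard he hprim hbasic (lt_of_le_of_ne hj hji.symm) (f ∘ₗ p j)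
      ext y
      obtain ⟨x, rfl⟩ := h.surj j y
      exact LinearMap.congr_fun h0 x
  have hloc : IsLocalModule Aᵐᵒᵖ (standard e i) :=
    (isLocalModule_P (hprim i)).of_surjective (Submodule.mkQ_surjective _)
  by_contra hcon
  -- If no map Θ(i) → Δ(i) is onto, all of them land in the radical of the local module Δ(i), and so
  -- does the projection e_i A → Δ(i), which is absurd.
  have hall : ∀ f ∈ factorSubgroup (P e i) (standard e i) (Θ i),
      ∀ x, f x ∈ Module.jacobson Aᵐᵒᵖ (standard e i) := by
    intro f hf
    induction hf using AddSubgroup.closure_induction with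
    | mem f hf =>
      obtain ⟨a, b, rfl⟩ := hf
      have hb : ¬ Function.Surjective b := fun hb ↦ hcon (nonempty_iso_of_surjective hb hq)
      exact fun x ↦ hloc.le_jacobson (mt LinearMap.range_eq_top.mp hb) ⟨a x, rfl⟩
    | zero => exact fun x ↦ zero_mem _
    | add f g _ _ hf hg => exact fun x ↦ add_mem (hf x) (hg x)
    | neg f _ hf => exact fun x ↦ neg_mem (hf x)
  refine (Module.jacobson_lt_top Aᵐᵒᵖ (standard e i)).ne (eq_top_iff.mpr fun y _ ↦ ?_)
  obtain ⟨x, rfl⟩ := Submodule.mkQ_surjective _ y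
  exact hall _ hmem x

lemma IsMixedStratifyingSystem.isMixedStratified (he : CompleteOrthogonalIdempotents e)
    (hprim : ∀ i, IsPrimitiveIdempotent (e i))
    (hbasic : ∀ i j, Nonempty (P e i ≅ P e j) → i = j)
    (h : IsMixedStratifyingSystem Θ (P e)) : IsMixedStratified e Θ := by
  obtain ⟨p, hp⟩ := h.exists_coverData hprim
  refine ⟨?_, fun i ↦ ?_⟩
  · obtain ⟨φ⟩ := nonempty_equiv_pi_P he
    refine Filt.of_equiv (X := ModuleCat.of Aᵐᵒᵖ (∀ i, P e i)) φ ?_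
    exact (extClosed_filt _).pi (fun X _ ↦ .of_subsingleton X) _
      fun i ↦ (hp.filtSet_P i).mono (Set.subset_univ _)
  · rcases h.brick_or_stone i with hi | hi
    · exact .inr (hp.iso_properStandard he hprim hbasic hi)
    · exact .inl (hp.iso_standard he hprim hbasic hi.2)

lemma IsStandardCover.isBrick {i : Fin n} {X : ModuleCat.{u} Aᵐᵒᵖ} [Module.Finite Aᵐᵒᵖ X]
    {p : P e i →ₗ[Aᵐᵒᵖ] X} (h : IsStandardCover e i X p)
    (H : ∀ f : P e i →ₗ[Aᵐᵒᵖ] X, f ≠ 0 → Function.Surjective f) : IsBrick X := by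
  have := h.nontrivial
  refine ⟨inferInstance, fun f hf ↦ (Module.End.isUnit_iff f).mpr ?_⟩
  have hs : Function.Surjective (f ∘ₗ p) := H _ fun h0 ↦ hf <| by
    ext y
    obtain ⟨x, rfl⟩ := h.surj y
    exact LinearMap.congr_fun h0 x
  have hs' : Function.Surjective f := fun y ↦ by
    obtain ⟨x, rfl⟩ := hs y
    exact ⟨p x, rfl⟩
  exact ⟨IsNoetherian.injective_of_surjective_endomorphism f hs', hs'⟩

lemma IsMixedStratified.isMixedStratifyingSystem (he : CompleteOrthogonalIdempotents e)
    (hprim : ∀ i, IsPrimitiveIdempotent (e i))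
    (hbasic : ∀ i j, Nonempty (P e i ≅ P e j) → i = j)
    (hΘ : ∀ i, Module.Finite Aᵐᵒᵖ (Θ i)) (h : IsMixedStratified e Θ) :
    IsMixedStratifyingSystem Θ (P e) := by
  choose p hp using fun i ↦ exists_isStandardCover he hprim hbasic (h.2 i)
  have hproj := fun i ↦ projective_P (hprim i).1
  have hom : ∀ i j, j < i → ∀ f : Θ i →ₗ[Aᵐᵒᵖ] Θ j, f = 0 := fun i j hij f ↦ by
    have h0 := (hp j).hom i hij (f ∘ₗ p i)
    ext y
    obtain ⟨x, rfl⟩ := (hp i).surj y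
    exact LinearMap.congr_fun h0 x
  have hext : ∀ i j, j < i → ExtVanish Aᵐᵒᵖ (Θ i) (Θ j) := fun i j hij ↦ by
    have := hproj i
    refine extVanish_of_extend (isSES_ker (hp i).surj) fun f ↦ ⟨0, ?_⟩
    rw [(hp i).ker_hom (Θ j) (fun l hl ↦ (hp j).hom l (hij.trans_le hl)) f, LinearMap.zero_comp]
  have hstone : ∀ i, (∀ Y : ModuleCat.{u} Aᵐᵒᵖ, (∀ j, i < j → ∀ f : P e j →ₗ[Aᵐᵒᵖ] Y, f = 0) →
      ∀ f : LinearMap.ker (p i) →ₗ[Aᵐᵒᵖ] Y, f = 0) → IsStone (Θ i) := fun i hi ↦ by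
    have := hproj i
    have := (hp i).nontrivial
    refine ⟨((isLocalModule_P (hprim i)).of_surjective (hp i).surj).indecomposable, ?_⟩
    refine extVanish_of_extend (isSES_ker (hp i).surj) fun f ↦ ⟨0, ?_⟩
    rw [hi (Θ i) (hp i).hom f, LinearMap.zero_comp]
  have hbs : ∀ i, IsBrick (Θ i) ∨ IsStone (Θ i) := fun i ↦
    (hp i).type.symm.imp (hp i).isBrick (hstone i)
  have hdir : ExtDirected Θ := ⟨hΘ, hom, hext, fun i ↦ (hbs i).imp_right fun h ↦ h.2⟩
  have hom_proj : ∀ i j, j < i → ∀ f : P e i →ₗ[Aᵐᵒᵖ] Θ j, f = 0 := fun i j hij ↦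
    (hp j).hom i hij
  have hP : ∀ i, FiltSet Θ (Set.Ici i) (P e i) := fun i ↦ by
    obtain ⟨φ⟩ := nonempty_equiv_pi_P he
    have hret : IsRetract Aᵐᵒᵖ (P e i) A := by
      refine IsRetract.trans (Y := ∀ i, P e i) ⟨LinearMap.single Aᵐᵒᵖ (fun i ↦ P e i) i,
        LinearMap.proj i, ?_⟩ (.of_equiv φ)
      exact LinearMap.proj_comp_single_same _ _ i
    have h1 : FiltSet Θ Set.univ (P e i) :=
      hdir.retractClosed _ (Y := ModuleCat.of Aᵐᵒᵖ A) hret h.1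
    rw [← Set.Iio_union_Ici (a := i), Set.union_comm] at h1
    obtain ⟨N, hN, hQ⟩ := hdir.filtSet_union (fun l hl j hj ↦ lt_of_lt_of_le hj hl) h1
    -- P(i) is an extension of a module in F(Θ(< i)) by one in F(Θ(≥ i)), and it has no nonzero map
    -- to the former.
    have h0 : N.mkQ = 0 := hQ.hom_eq_zero' (fun j hj ↦ hom_proj i j hj) _
    have htop : N = ⊤ := by rw [← Submodule.ker_mkQ N, h0, LinearMap.ker_zero]
    exact Filt.of_equiv (X := ModuleCat.of Aᵐᵒᵖ N) (LinearEquiv.ofTop N htop) hN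
  have hker : ∀ i, FiltSet Θ (Set.Ici i) (ModuleCat.of Aᵐᵒᵖ (LinearMap.ker (p i))) := fun i ↦ by
    rcases (hp i).type with hi | hi
    · have h1 := hP i
      rw [← Set.Ioi_insert, Set.insert_eq, Set.union_comm] at h1
      obtain ⟨N, hN, hQ⟩ := hdir.filtSet_union (by rintro l hl _ rfl; exact hl) h1
      -- N is the part of P(i) filtered by Θ(> i). It is killed by p(i) because Hom(Θ(j), Θ(i)) = 0
      -- for j > i, and ker (p i) has no maps to P(i)/N, which is filtered by Θ(i).
      have hNK : N = LinearMap.ker (p i) := by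
        refine le_antisymm (fun x hx ↦ ?_) fun x hx ↦ ?_
        · have h0 := hN.hom_eq_zero (fun j hj ↦ hom j i hj) (p i ∘ₗ N.subtype)
          exact LinearMap.congr_fun h0 ⟨x, hx⟩
        · have h0 := hi (ModuleCat.of Aᵐᵒᵖ (P e i ⧸ N))
            (fun j hj ↦ hQ.hom_eq_zero' (by rintro _ rfl; exact hom_proj j _ hj))
            (N.mkQ ∘ₗ (LinearMap.ker (p i)).subtype)
          exact (Submodule.Quotient.mk_eq_zero N).mp (LinearMap.congr_fun h0 ⟨x, hx⟩)
      rw [hNK] at hN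
      exact hN.mono Set.Ioi_subset_Ici_self
    · refine ((hP i).ker_of_brick ((hp i).isBrick hi)
        (fun j hj hji ↦ hom j i (lt_of_le_of_ne hj hji.symm)) fun h0 ↦ ?_).2
      obtain ⟨y, hy⟩ := @exists_ne _ (hp i).nontrivial (0 : Θ i)
      obtain ⟨x, rfl⟩ := (hp i).surj y
      exact hy (LinearMap.congr_fun h0 x)
  refine ⟨hΘ, fun i ↦ inferInstance, fun i ↦ (isLocalModule_P (hprim i)).indecomposable, hbs,
    fun i j hij f ↦ ModuleCat.hom_ext (hom i j hij f.hom), fun i ↦ ?_, fun i X _ ↦ ?_⟩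
  · exact ⟨_, _, _, _, (isSES_ker (hp i).surj).shortExact_ofHom, hker i⟩
  · have := hproj i
    exact extVanish_of_projective (R := Aᵐᵒᵖ) (Q := P e i) (Y := X)

lemma IsMixedStratifyingSystem.exists_isMixedBistratifyingSystem (k : Type*) [Field k]
    [Algebra k A] [FiniteDimensional k A] (hprim : ∀ i, IsPrimitiveIdempotent (e i))
    (h : IsMixedStratifyingSystem Θ (P e)) :
    ∃ T : Fin n → ModuleCat.{u} Aᵐᵒᵖ, IsMixedBistratifyingSystem Θ (P e) T := by
  obtain ⟨p, hp⟩ := h.exists_coverData hprim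
  choose T ι hT hind using hp.exists_indecomposable_isExtHull k
  refine ⟨T, h, h.finite_left, fun i ↦ (hT i).finite hp.toExtDirected, hind, h.brick_or_stone,
    h.hom_eq_zero, fun i ↦ ?_, fun i X hX ↦ ?_⟩
  · exact ⟨_, _, _, _, (isSES_range (hT i).inj).shortExact_ofHom, (hT i).coker⟩
  · exact hX.extVanish_left fun j _ ↦ (hT i).ext j (Nat.zero_le _)

end Equivalences

end MixedStrat

theorem theorem4p3 {k : Type*} {A : Type u} [Field k] [Ring A] [Algebra k A]
    [FiniteDimensional k A] {n : ℕ} (e : Fin n → A)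
    (he : CompleteOrthogonalIdempotents e)
    (hprim : ∀ i, MixedStrat.IsPrimitiveIdempotent (e i))
    (hbasic : ∀ i j, Nonempty (MixedStrat.P e i ≅ MixedStrat.P e j) → i = j)
    (Θ : Fin n → ModuleCat.{u} Aᵐᵒᵖ) (hΘ : ∀ i, Module.Finite Aᵐᵒᵖ (Θ i)) :
    List.TFAE [
      MixedStrat.IsMixedStratified e Θ,
      MixedStrat.IsMixedStratifyingSystem Θ (MixedStrat.P e),
      ∃ T : Fin n → ModuleCat.{u} Aᵐᵒᵖ,
        MixedStrat.IsMixedBistratifyingSystem Θ (MixedStrat.P e) T] := by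
  have : IsArtinianRing Aᵐᵒᵖ := IsArtinianRing.of_finite k _
  tfae_have 1 → 2 := fun h ↦ h.isMixedStratifyingSystem he hprim hbasic hΘ
  tfae_have 2 → 1 := fun h ↦ h.isMixedStratified he hprim hbasic
  tfae_have 2 → 3 := fun h ↦ h.exists_isMixedBistratifyingSystem k hprim
  tfae_have 3 → 2 := fun ⟨_, h⟩ ↦ h.1
  tfae_finish
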